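/- **Setting.** Let $(V,\|\cdot\|)$ be a separable real Banach space with the Radon–Nikodým property, $V^*$ its dual with norm $\|\cdot\|_*$, and $T>0$. Let $\Psi:V\to[0,\infty)$ be continuous, convex, strictly positive on $V\setminus\{0\}$ and positively $1$-homogeneous (not necessarily symmetric). Let $\Phi(v)=F(\|v\|)$ with $F\in C^1([0,\infty))$ convex, $F(r)>0$ for $r>0$, $F(0)=F'(0)=0$, $F'(r)\to\infty$ as $r\to\infty$. For $\varepsilon>0$ put $\Psi_\varepsilon(v)=\Psi(v)+\varepsilon^{-1}\Phi(\varepsilon v)$ and $\Psi_\varepsilon^*(\xi)=\sup_{v}(\langle\xi,v\rangle-\Psi_\varepsilon(v))$. Let $D\subset V$ and let $\mathcal E:[0,T]\times D\to\mathbb R$ be lower semicontinuous ($\mathcal E_t=+\infty$ off $D$), with Fréchet subdifferential $\partial\mathcal E_t(u)\subset V^*$, such that: * for every $E>0$ the set $D_E=\{u\in D:\Psi(u)+\sup_{t\in[0,T]}\mathcal E_t(u)\le E\}$ is compact; * for every $u\in D$, $t\mapsto\mathcal E_t(u)$ is differentiable on $[0,T]$, and there is $C_P\ge0$ such that for all $(t,u)\in(0,T)\times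 D$ and $E>0$: $|\partial_t\mathcal E_t(u)|\le C_P(\Psi(u)+\mathcal E_t(u))$ and $\limsup_{w\to u,\,w\in D_E}\partial_t\mathcal E_t(w)\le\partial_t\mathcal E_t(u)$; * for every $E>0$ there is an upper semicontinuous $\omega^E:[0,T]\times D_E\times D_E\to\mathbb R$ with $\omega^E_t(u,u)=0$ and $\mathcal E_t(v)\ge\mathcal E_t(u)+\langle\xi,v-u\rangle-\omega^E_t(u,v)\min\{\Psi(v-u),\Psi(u-v)\}$ for all $t\in[0,T]$, $u,v\in D_E$, $\xi\in\partial\mathcal E_t(u)$. A curve $u:[a,b]\to V$ is $\Psi$-absolutely continuous if there is a nonnegative $m\in L^1(a,b)$ with $\Psi(u(r)-u(s))\le\int_s^r m$ for $a\le s\le r\le b$; then its metric derivative $\Psi[u'](r)=\lim_{h\to0}\Psi\big((u(r+h)-u(r))/h\big)$ exists a.e. $AC([a,b];V)$ denotes absolutely continuous curves with respect to $\|\cdot\|$. Let $K^*=\{z\in V^*:\langle z,w\rangle\le\Psi(w)\ \forall w\in V\}$, $$\mathfrak p(v,\xi)=\inf_{\varepsilon>0}\big(\Psi_\varepsilon(v)+\Psi_\varepsilon^*(\xi)\big),\quad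 \mathfrak f_t(u,v)=\inf\{\mathfrak p(v,\xi):\xi\in-\partial\mathcal E_t(u)\}\ (v\ne0),\quad \mathfrak f_t(u,0)=0,$$ $$\mathfrak e_t(u)=\inf\{\|\xi-z\|_*:\xi\in-\partial\mathcal E_t(u),\ z\in K^*\},\qquad \inf\emptyset=+\infty .$$ For $t\in[0,T]$ and $u_0,u_1\in D$ let $\mathcal T_t(u_0,u_1)$ be the set of admissible transitions: curves $\vartheta:[0,1]\to V$ with $\vartheta(0)=u_0$, $\vartheta(1)=u_1$, with values in some $D_{E'}$, $\Psi$-absolutely continuous, and locally absolutely continuous with respect to $\|\cdot\|$ on $G_t[\vartheta]=\{r\in[0,1]:\mathfrak e_t(\vartheta(r))>0\}$. Put $\mathfrak f_t[\vartheta,\vartheta'](r)=\mathfrak f_t(\vartheta(r),\dot\vartheta(r))$ if $r\in G_t[\vartheta]$ and $\mathfrak f_t[\vartheta,\vartheta'](r)=\Psi[\vartheta'](r)$ otherwise, and $$\Delta_{\mathfrak f_t}(u_0,u_1)=\inf_{\vartheta\in\mathcal T_t(u_0,u_1)}\int_0^1\mathfrak f_t[\vartheta,\vartheta'](r)\,dr\in[0,\infty].$$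 **Theorem.** Let $t\in[0,T]$, $E>0$ and $u_-,u_+\in D_E$. **(F1)** If $\Delta_{\mathfrak f_t}(u_-,u_+)<\infty$, the infimum is attained by some $\vartheta\in\mathcal T_t(u_-,u_+)$. Moreover $$\Delta_{\mathfrak f_t}(u_-,u_+)\ \ge\ \mathcal E_t(u_-)-\mathcal E_t(u_+),$$ and, if $\Psi$ is symmetric ($\Psi(-v)=\Psi(v)$ for all $v$), $\Delta_{\mathfrak f_t}(u_-,u_+)\ge|\mathcal E_t(u_-)-\mathcal E_t(u_+)|$. **(F2)** If $u_{0,n},u_{1,n}\in D_E$, $u_{0,n}\to u_-$ and $u_{1,n}\to u_+$ strongly in $V$, then $\liminf_n\Delta_{\mathfrak f_t}(u_{0,n},u_{1,n})\ge\Delta_{\mathfrak f_t}(u_-,u_+)$. **(F3)** Let $[\alpha_n,\beta_n]\subset[0,T]$, $u_n\in AC([\alpha_n,\beta_n];V)$, $\tilde u_n:[\alpha_n,\beta_n]\to D_E$ measurable, $\xi_n\in L^1(\alpha_n,\beta_n;V^*)$, and $\varepsilon_n>0$ with $\varepsilon_n\to0$, be such that $\sup_{r\in[\alpha_n,\beta_n]}\|\tilde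 u_n(r)-u_n(r)\|\to0$, $\xi_n(r)\in-\partial\mathcal E_r(\tilde u_n(r))$ for a.a. $r\in(\alpha_n,\beta_n)$, $u_n(\alpha_n)\to u_-$, $u_n(\beta_n)\to u_+$, $\alpha_n\to t$ and $\beta_n\to t$. If $$\Delta:=\lim_{n\to\infty}\int_{\alpha_n}^{\beta_n}\big(\Psi_{\varepsilon_n}(\dot u_n)+\Psi^*_{\varepsilon_n}(\xi_n)\big)\,dr$$ exists and is finite, then there are a strictly increasing sequence of indices $(n_k)_k$, absolutely continuous surjective rescalings $\mathsf t_{n_k}:[0,1]\to[\alpha_{n_k},\beta_{n_k}]$, nondecreasing and strictly increasing whenever $\alpha_{n_k}<\beta_{n_k}$, and an admissible transition $\vartheta\in\mathcal T_t(u_-,u_+)$ such that $u_{n_k}\circ\mathsf t_{n_k}\to\vartheta$ strongly in $V$, uniformly on $[0,1]$, and $\int_0^1\mathfrak f_t[\vartheta,\vartheta'](r)\,dr\le\Delta$. Moreover, whether or not this limit exists or is finite, $$\liminf_{n\to\infty}\int_{\alpha_n}^{\beta_n}\big(\Psi_{\varepsilon_n}(\dot u_n)+\Psi^*_{\varepsilon_n}(\xi_n)\big)\,dr\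 \ge\ \Delta_{\mathfrak f_t}(u_-,u_+).$$ -/

import Mathlib

open Set Filter Topology MeasureTheory
open scoped ENNReal

noncomputable section

/-- A curve `u : [a,b] → V` is `Ψ`-absolutely continuous: there is a nonnegative `m ∈ L¹(a,b)` with
`Ψ (u t - u s) ≤ ∫ₛᵗ m` for all `a ≤ s ≤ t ≤ b`. Only the values of `u` on `[a,b]` matter.
For `Ψ = ‖·‖` this is ordinary (norm) absolute continuity. -/
def GaugeAC {V : Type*} [AddCommGroup V] (Ψ : V → ℝ) (u : ℝ → V) (a b : ℝ) : Prop :=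
  ∃ m : ℝ → ℝ, (∀ r, 0 ≤ m r) ∧ IntegrableOn m (Icc a b) ∧
    ∀ s t : ℝ, a ≤ s → s ≤ t → t ≤ b → Ψ (u t - u s) ≤ ∫ r in s..t, m r

/-- Absolutely continuous curves with values in the normed space `V`: the class `AC([a,b];V)`. -/
def NormAC {V : Type*} [NormedAddCommGroup V] (u : ℝ → V) (a b : ℝ) : Prop :=
  GaugeAC (fun v : V => ‖v‖) u a b

/-- The class `AC_loc(G;V)`: norm absolute continuity on each compact interval contained in `G`. -/
def NormACLoc {V : Type*} [NormedAddCommGroup V] (u : ℝ → V) (G : Set ℝ) : Prop :=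
  ∀ a b : ℝ, a ≤ b → Icc a b ⊆ G → NormAC u a b

/-- The Radon–Nikodým property: absolutely continuous curves with values in `V` are almost
everywhere differentiable. -/
def RadonNikodymProperty (V : Type*) [NormedAddCommGroup V] [NormedSpace ℝ V] : Prop :=
  ∀ (u : ℝ → V) (a b : ℝ), NormAC u a b →
    ∀ᵐ r ∂(volume.restrict (Ioo a b)), DifferentiableAt ℝ u r

/-- The `Ψ`-metric derivative `lim_{h → 0} Ψ ((u (t + h) - u t) / h)`, as a `limsup`, which is
the limit wherever the limit exists (almost everywhere for a `Ψ`-absolutely continuous curve). -/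
def metricDeriv {V : Type*} [AddCommGroup V] [Module ℝ V] (Ψ : V → ℝ) (u : ℝ → V) (t : ℝ) :
    ℝ≥0∞ :=
  limsup (fun h : ℝ => ENNReal.ofReal (Ψ (h⁻¹ • (u (t + h) - u t)))) (𝓝[≠] (0 : ℝ))

/-- The data of a rate-independent system with viscous regularisation: a final time `T`, a
rate-independent potential `Ψ`, the profile `F` of the viscous potential `Φ v = F ‖v‖`, the energy
domain `D` and the energy `E : [0,T] × D → ℝ` (thought of as `+∞` outside `D`; the values of `E`
outside `[0,T] × D` are never used). -/
structure RISystem (V : Type*) where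
  T : ℝ
  Ψ : V → ℝ
  F : ℝ → ℝ
  D : Set V
  E : ℝ → V → ℝ

namespace RISystem

variable {V : Type*} [NormedAddCommGroup V] [NormedSpace ℝ V] (S : RISystem V)

/-- The sublevel `D_e = {u ∈ D : Ψ u + sup_{t ∈ [0,T]} E_t u ≤ e}`. -/
def sublevel (e : ℝ) : Set V :=
  {u | u ∈ S.D ∧ ∀ t ∈ Icc (0 : ℝ) S.T, S.Ψ u + S.E t u ≤ e}

/-- The power `∂ₜ E_t u` (one-sided derivative at `t = 0` and `t = T`). -/
def power (t : ℝ) (u : V) : ℝ := derivWithin (fun s => S.E s u) (Icc (0 : ℝ) S.T) t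

/-- The Fréchet subdifferential of `E_t` at `u ∈ D`:
`E_t v - E_t u - ⟨ξ, v - u⟩ ≥ o(‖v - u‖)` as `v → u`; points `v ∉ D` impose no condition since
`E_t v = +∞` there. -/
def subdiff (t : ℝ) (u : V) : Set (V →L[ℝ] ℝ) :=
  {ξ | u ∈ S.D ∧ ∀ δ : ℝ, 0 < δ →
    ∀ᶠ v in 𝓝[S.D] u, -(δ * ‖v - u‖) ≤ S.E t v - S.E t u - ξ (v - u)}

/-- The stable set `K* = {ξ ∈ V* : ⟨ξ, w⟩ ≤ Ψ w for all w}`. -/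
def stableSet : Set (V →L[ℝ] ℝ) := {ξ | ∀ w : V, ξ w ≤ S.Ψ w}

/-- The viscous potentials `Ψ_ε v = Ψ v + ε⁻¹ Φ (ε v)` with `Φ v = F ‖v‖`. -/
def viscous (ε : ℝ) (v : V) : ℝ := S.Ψ v + ε⁻¹ * S.F ‖ε • v‖

/-- The conjugate `Ψ_ε* ξ = sup_v (⟨ξ, v⟩ - Ψ_ε v)`. Since `v = 0` competes with the value `0`, the
supremum is nonnegative, and truncating the competitors at `0` does not change it. -/
def viscousConj (ε : ℝ) (ξ : V →L[ℝ] ℝ) : ℝ≥0∞ :=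
  ⨆ v : V, ENNReal.ofReal (ξ v - S.viscous ε v)

/-- The vanishing-viscosity contact potential `𝔭(v, ξ) = inf_{ε > 0} (Ψ_ε v + Ψ_ε* ξ)`. -/
def contactPotential (v : V) (ξ : V →L[ℝ] ℝ) : ℝ≥0∞ :=
  ⨅ (ε : ℝ) (_ : 0 < ε), ENNReal.ofReal (S.viscous ε v) + S.viscousConj ε ξ

/-- `𝔢_t(u) = inf {‖ξ - z‖_* : ξ ∈ -∂E_t(u), z ∈ K*}`, equal to `∞` if `∂E_t(u)` is empty. -/
def instability (t : ℝ) (u : V) : ℝ≥0∞ :=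
  ⨅ (ξ : V →L[ℝ] ℝ) (_ : -ξ ∈ S.subdiff t u) (z : V →L[ℝ] ℝ) (_ : z ∈ S.stableSet),
    ENNReal.ofReal ‖ξ - z‖

open Classical in
/-- The Finsler dissipation functional `𝔣_t(u; v) = inf {𝔭(v, ξ) : ξ ∈ -∂E_t(u)}`, with
`inf ∅ = ∞` for `v ≠ 0` and `𝔣_t(u; 0) = 0`. This is `Ψ v + 𝔢_t(u) ‖v‖` with the convention
`∞ · 0 = 0`; the case `v = 0` is separated only because of that convention. -/
def finsler (t : ℝ) (u v : V) : ℝ≥0∞ :=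
  if v = 0 then 0
  else ⨅ (ξ : V →L[ℝ] ℝ) (_ : -ξ ∈ S.subdiff t u), S.contactPotential v ξ

/-- The set `G_t[ϑ] = {r ∈ [0,1] : 𝔢_t(ϑ r) > 0}`. -/
def unstableTimes (t : ℝ) (ϑ : ℝ → V) : Set ℝ :=
  {r | r ∈ Icc (0 : ℝ) 1 ∧ 0 < S.instability t (ϑ r)}

/-- The class `𝒯_t(u₀, u₁)` of admissible transition curves `ϑ : [0,1] → V` from `u₀` to `u₁`:
`ϑ ∈ AC([0,1]; D_e, Ψ)` for some `e > 0` and `ϑ ∈ AC_loc(G_t[ϑ]; V)`. -/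
structure IsTransition (t : ℝ) (u₀ u₁ : V) (ϑ : ℝ → V) : Prop where
  exists_sublevel : ∃ e : ℝ, 0 < e ∧ ∀ r ∈ Icc (0 : ℝ) 1, ϑ r ∈ S.sublevel e
  gaugeAC : GaugeAC S.Ψ ϑ 0 1
  normACLoc : NormACLoc ϑ (S.unstableTimes t ϑ)
  left_end : ϑ 0 = u₀
  right_end : ϑ 1 = u₁

open Classical in
/-- The density `𝔣_t[ϑ; ϑ'](r)`: it is `𝔣_t(ϑ r; ϑ' r)` for `r ∈ G_t[ϑ]`, and the `Ψ`-metric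
derivative of `ϑ` at `r` otherwise. -/
def costDensity (t : ℝ) (ϑ : ℝ → V) (r : ℝ) : ℝ≥0∞ :=
  if r ∈ S.unstableTimes t ϑ then S.finsler t (ϑ r) (deriv ϑ r) else metricDeriv S.Ψ ϑ r

/-- `∫₀¹ 𝔣_t[ϑ; ϑ'](r) dr`. -/
def curveCost (t : ℝ) (ϑ : ℝ → V) : ℝ≥0∞ :=
  ∫⁻ r in Ioo (0 : ℝ) 1, S.costDensity t ϑ r

/-- The Finsler dissipation cost `Δ_{𝔣_t}(u₀, u₁)`, equal to `∞` if there is no transition. -/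
def cost (t : ℝ) (u₀ u₁ : V) : ℝ≥0∞ :=
  ⨅ (ϑ : ℝ → V) (_ : S.IsTransition t u₀ u₁ ϑ), S.curveCost t ϑ

/-- The viscous dissipation `∫_α^β (Ψ_ε(u') + Ψ_ε*(ξ)) dr`. -/
def viscousDissipation (ε α β : ℝ) (u : ℝ → V) (ξ : ℝ → V →L[ℝ] ℝ) : ℝ≥0∞ :=
  ∫⁻ r in Ioo α β, (ENNReal.ofReal (S.viscous ε (deriv u r)) + S.viscousConj ε (ξ r))

/-- The standing assumptions on the dissipation potentials and on the energy. -/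
structure Standing : Prop where
  T_pos : 0 < S.T
  -- the rate-independent potential: continuous, convex, positive off `0`, positively 1-homogeneous
  psi_continuous : Continuous S.Ψ
  psi_convex : ConvexOn ℝ univ S.Ψ
  psi_nonneg : ∀ v, 0 ≤ S.Ψ v
  psi_pos : ∀ v, v ≠ 0 → 0 < S.Ψ v
  psi_homogeneous : ∀ (c : ℝ) (v : V), 0 ≤ c → S.Ψ (c • v) = c * S.Ψ v
  -- the profile of the viscous potential
  F_contDiff : ContDiffOn ℝ 1 S.F (Ici 0)
  F_convex : ConvexOn ℝ (Ici 0) S.F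
  F_pos : ∀ r, 0 < r → 0 < S.F r
  F_zero : S.F 0 = 0
  F_deriv_zero : derivWithin S.F (Ici 0) 0 = 0
  F_deriv_tendsto : Tendsto (derivWithin S.F (Ici 0)) atTop atTop
  -- lower semicontinuity of the energy
  E_lsc : LowerSemicontinuousOn (fun p : ℝ × V => S.E p.1 p.2) (Icc (0 : ℝ) S.T ×ˢ S.D)
  -- coercivity
  E_coercive : ∀ e : ℝ, 0 < e → IsCompact (S.sublevel e)
  -- power control
  E_differentiable : ∀ u ∈ S.D, DifferentiableOn ℝ (fun s => S.E s u) (Icc (0 : ℝ) S.T)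
  power_bound : ∃ C : ℝ, 0 ≤ C ∧
    ∀ t ∈ Ioo (0 : ℝ) S.T, ∀ u ∈ S.D, |S.power t u| ≤ C * (S.Ψ u + S.E t u)
  power_usc : ∀ t ∈ Ioo (0 : ℝ) S.T, ∀ u ∈ S.D, ∀ e : ℝ, 0 < e →
    UpperSemicontinuousWithinAt (S.power t) (S.sublevel e) u
  -- uniform subdifferentiability
  E_subdiff : ∀ e : ℝ, 0 < e → ∃ ω : ℝ × V × V → ℝ,
    UpperSemicontinuousOn ω (Icc (0 : ℝ) S.T ×ˢ S.sublevel e ×ˢ S.sublevel e) ∧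
    (∀ t ∈ Icc (0 : ℝ) S.T, ∀ u ∈ S.sublevel e, ω (t, u, u) = 0) ∧
    ∀ t ∈ Icc (0 : ℝ) S.T, ∀ u ∈ S.sublevel e, ∀ v ∈ S.sublevel e, ∀ ξ ∈ S.subdiff t u,
      S.E t u + ξ (v - u) - ω (t, u, v) * min (S.Ψ (v - u)) (S.Ψ (-(v - u))) ≤ S.E t v

/-- Viscous-type sequences concentrating at the time `t` and connecting `u₀` to `u₁` in the limit:
`[α n, β n] ⊆ [0,T]` shrinks to `t`, `u n ∈ AC([α n, β n]; V)`, `w n` is a measurable curve in `D_e`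
uniformly close to `u n`, `ξ n ∈ L¹(α n, β n; V*)` is a selection of `-∂E_r(w n r)`, and `ε n ↓ 0`. -/
structure IsConcentrating (e t : ℝ) (u₀ u₁ : V) (α β : ℕ → ℝ) (u w : ℕ → ℝ → V)
    (ξ : ℕ → ℝ → V →L[ℝ] ℝ) (ε : ℕ → ℝ) : Prop where
  interval : ∀ n, 0 ≤ α n ∧ α n ≤ β n ∧ β n ≤ S.T
  u_ac : ∀ n, NormAC (u n) (α n) (β n)
  w_mem : ∀ n, ∀ r ∈ Icc (α n) (β n), w n r ∈ S.sublevel e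
  w_meas : ∀ n, AEStronglyMeasurable (w n) (volume.restrict (Icc (α n) (β n)))
  xi_integrable : ∀ n, IntegrableOn (ξ n) (Ioo (α n) (β n))
  eps_pos : ∀ n, 0 < ε n
  eps_tendsto : Tendsto ε atTop (𝓝 0)
  close : ∀ δ : ℝ, 0 < δ → ∀ᶠ n in atTop, ∀ r ∈ Icc (α n) (β n), ‖w n r - u n r‖ ≤ δ
  xi_mem : ∀ n, ∀ᵐ r ∂(volume.restrict (Ioo (α n) (β n))), -(ξ n r) ∈ S.subdiff r (w n r)
  u_left : Tendsto (fun n => u n (α n)) atTop (𝓝 u₀)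
  u_right : Tendsto (fun n => u n (β n)) atTop (𝓝 u₁)
  alpha_tendsto : Tendsto α atTop (𝓝 t)
  beta_tendsto : Tendsto β atTop (𝓝 t)

end RISystem

end

/-! The Finsler density is `Ψ v + 𝔢_t(u) ‖v‖`. By Hahn–Banach, `ξ` lies within `c` of `K*` as soon
as `ξ ≤ Ψ + c ‖·‖` (`IsGauge.exists_norm_sub_le`), so distances to `K*` become pointwise
inequalities. Choosing `ε` where `F` has slope `c` bounds the density from above (`finsler_le`). The
lower bound (`le_viscous_add_viscousConj`) holds for every single `ε`, so viscous dissipation and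
transition cost obey the same estimate.

On sublevels `𝔢` is jointly lower semicontinuous in time and state (`eventually_lt_instability`), by
weak* compactness of the relevant subgradients and closedness of the subdifferential. Curves are
treated through an inequality without derivatives (`IsMajorant`): `Ψ` of an increment plus `c` times
its norm is at most `∫ m` wherever `c ≤ 𝔢`. The Radon–Nikodým property provides it for transitions
of finite cost and, in analogous form, for viscous curves. Reparametrized by arc length, `m` is
replaced by a constant; Ascoli gives a uniform limit, semicontinuity of `𝔢` lets the inequality pass
to it, and difference quotients bound its cost density by the limit constant
(`exists_limit_transition`). Existence of minimisers, (F2) and (F3) all follow from this.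

The energy bound is a chain rule inequality (`IsMajorant.energy_sub_le`). It is delicate because the
energy is only lower semicontinuous and `𝔢` may be unbounded or infinite along the curve. A dyadic
chain first gives a crude bound `K ∫ m` on the energy drop (`IsMajorant.exists_energy_sub_le`).
Hence energy plus `K ∫ m` is monotone, thus a.e. differentiable, and the constant can be sharpened
to `1` pointwise. The chain rule also keeps transitions of bounded cost between points of one
sublevel in a common sublevel, which is the compactness used for (F1) and (F2). For symmetric `Ψ`,
time reversal gives the absolute value. -/

/-- Nonnegative, subadditive and positively homogeneous functions (asymmetric seminorms). -/
structure IsGauge {V : Type*} [AddCommGroup V] [Module ℝ V] (N : V → ℝ) : Prop where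
  nonneg : ∀ v, 0 ≤ N v
  add_le : ∀ v w, N (v + w) ≤ N v + N w
  smul_eq : ∀ (c : ℝ) (v : V), 0 ≤ c → N (c • v) = c * N v

/-! ### Gauges and a Hahn–Banach sandwich. -/

namespace IsGauge

variable {V : Type*} [NormedAddCommGroup V] [NormedSpace ℝ V] {N : V → ℝ}

lemma map_zero (hN : IsGauge N) : N 0 = 0 := by
  simpa using hN.smul_eq 0 0 le_rfl

lemma sub_le (hN : IsGauge N) (u v w : V) : N (u - w) ≤ N (u - v) + N (v - w) := by
  simpa using hN.add_le (u - v) (v - w)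

lemma add_norm (hN : IsGauge N) {c : ℝ} (hc : 0 ≤ c) : IsGauge (fun v => N v + c * ‖v‖) where
  nonneg v := add_nonneg (hN.nonneg v) (by positivity)
  add_le v w := by nlinarith [hN.add_le v w, norm_add_le v w]
  smul_eq a v ha := by rw [hN.smul_eq a v ha, norm_smul, Real.norm_of_nonneg ha]; ring

lemma exists_le_mul_norm (hN : IsGauge N) (hc : Continuous N) :
    ∃ L : ℝ, 0 < L ∧ ∀ v, N v ≤ L * ‖v‖ := by
  have h0 : ∀ᶠ v in 𝓝 (0 : V), N v < 1 :=
    hc.continuousAt.eventually_lt_const (by rw [hN.map_zero]; exact one_pos)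
  obtain ⟨δ, hδ, h⟩ := Metric.eventually_nhds_iff.1 h0
  refine ⟨2 / δ, by positivity, fun v => ?_⟩
  rcases eq_or_ne v 0 with rfl | hv
  · simp [hN.map_zero]
  have hv' : 0 < ‖v‖ := norm_pos_iff.2 hv
  have h1 := h (y := (δ / (2 * ‖v‖)) • v) (by
    rw [dist_zero_right, norm_smul, Real.norm_of_nonneg (by positivity)]
    field_simp; norm_num)
  rw [hN.smul_eq _ _ (by positivity), div_mul_eq_mul_div, div_lt_one (by positivity)] at h1
  rw [div_mul_eq_mul_div, le_div_iff₀ hδ]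
  linarith

/-- A functional below `N + c ‖·‖` is within distance `c` of a functional below `N`. -/
lemma exists_norm_sub_le (hN : IsGauge N) (hcont : Continuous N) {c : ℝ} (hc : 0 ≤ c)
    (ξ : V →L[ℝ] ℝ) (hξ : ∀ v, ξ v ≤ N v + c * ‖v‖) :
    ∃ z : V →L[ℝ] ℝ, (∀ v, z v ≤ N v) ∧ ‖ξ - z‖ ≤ c := by
  -- On the diagonal of `V × V`, `ξ` is dominated by the sublinear map `N p.1 + c * ‖p.2‖`. An
  -- extension `g` splits `ξ v` as `g (v, 0) + g (0, v)`: the first part is `z`, the second is `ξ -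
  -- z`.
  let diag : V →ₗ[ℝ] V × V := LinearMap.prod LinearMap.id LinearMap.id
  let f : V × V →ₗ.[ℝ] ℝ :=
    ⟨LinearMap.range diag, (ξ : V →ₗ[ℝ] ℝ).comp ((LinearMap.fst ℝ V V).comp
      (LinearMap.range diag).subtype)⟩
  obtain ⟨g, hg, hgN⟩ := exists_extension_of_le_sublinear f (fun p => N p.1 + c * ‖p.2‖)
    (fun a ha p => by
      simp only [Prod.smul_fst, Prod.smul_snd, norm_smul, Real.norm_of_nonneg ha.le,
        hN.smul_eq a _ ha.le]; ring)
    (fun p q => by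
      simp only [Prod.fst_add, Prod.snd_add]
      nlinarith [hN.add_le p.1 q.1, norm_add_le p.2 q.2])
    (by
      rintro ⟨_, ⟨v, rfl⟩⟩
      exact hξ v)
  have hdiag : ∀ v, g (v, v) = ξ v := fun v => hg ⟨(v, v), ⟨v, rfl⟩⟩
  have hle : ∀ v, g (v, 0) ≤ N v := fun v => by simpa using hgN (v, 0)
  obtain ⟨L, hL, hNL⟩ := hN.exists_le_mul_norm hcont
  let z : V →L[ℝ] ℝ := LinearMap.mkContinuous (g.comp (LinearMap.inl ℝ V V)) L (fun v => by
    have h1 := (hle v).trans (hNL v)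
    have h2 := (hle (-v)).trans (hNL (-v))
    have h3 : g (-v, 0) = - g (v, 0) := by rw [← _root_.map_neg]; simp
    rw [h3, norm_neg] at h2
    rw [Real.norm_eq_abs, abs_le]
    simp only [LinearMap.comp_apply, LinearMap.inl_apply]
    constructor <;> linarith)
  have hz : ∀ v, z v = g (v, 0) := fun v => rfl
  refine ⟨z, fun v => hz v ▸ hle v, ?_⟩
  have hd : ∀ v, (ξ - z) v ≤ c * ‖v‖ := fun v => by
    have : (ξ - z) v = g (0, v) := by
      rw [sub_apply, hz, ← hdiag, ← map_sub]; simp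
    rw [this]
    simpa [hN.map_zero] using hgN (0, v)
  refine ContinuousLinearMap.opNorm_le_bound _ hc fun v => ?_
  have h2 := hd (-v)
  rw [_root_.map_neg, norm_neg] at h2
  rw [Real.norm_eq_abs, abs_le]
  exact ⟨by linarith, hd v⟩

end IsGauge

/-! ### The contact potential and the formula for the Finsler density. -/

namespace RISystem

variable {V : Type*} [NormedAddCommGroup V] [NormedSpace ℝ V] {S : RISystem V}

lemma Standing.isGauge (hS : S.Standing) : IsGauge S.Ψ where
  nonneg := hS.psi_nonneg
  add_le v w := by
    have h := hS.psi_convex.2 (mem_univ v) (mem_univ w)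
      (by norm_num : (0 : ℝ) ≤ 1 / 2) (by norm_num : (0 : ℝ) ≤ 1 / 2) (by norm_num)
    rw [← smul_add, hS.psi_homogeneous _ _ (by norm_num)] at h
    simp only [smul_eq_mul] at h
    linarith
  smul_eq c v hc := hS.psi_homogeneous c v hc

/-- Hahn–Banach turns the distance to `K*` into a pointwise inequality, which survives weak* limits
and can be tested on single vectors. -/
lemma instability_le (hS : S.Standing) {t : ℝ} {u : V} {c : ℝ} (hc : 0 ≤ c) {ξ : V →L[ℝ] ℝ}
    (hξ : -ξ ∈ S.subdiff t u) (h : ∀ v, ξ v ≤ S.Ψ v + c * ‖v‖) :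
    S.instability t u ≤ ENNReal.ofReal c := by
  obtain ⟨z, hz, hzc⟩ := hS.isGauge.exists_norm_sub_le hS.psi_continuous hc ξ h
  exact (iInf₂_le_of_le ξ hξ (iInf₂_le_of_le z hz le_rfl)).trans (ENNReal.ofReal_le_ofReal hzc)

lemma exists_of_instability_lt {t : ℝ} {u : V} {c : ℝ}
    (h : S.instability t u < ENNReal.ofReal c) :
    ∃ ξ : V →L[ℝ] ℝ, -ξ ∈ S.subdiff t u ∧ ∀ v, ξ v ≤ S.Ψ v + c * ‖v‖ := by
  simp only [instability, iInf_lt_iff] at h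
  obtain ⟨ξ, hξ, z, hz, hlt⟩ := h
  refine ⟨ξ, hξ, fun v => ?_⟩
  have h1 : ‖ξ - z‖ ≤ c := by
    by_contra! hcon
    exact absurd hlt (not_lt.2 (ENNReal.ofReal_le_ofReal hcon.le))
  have h2 : ξ v - z v ≤ ‖ξ - z‖ * ‖v‖ := (le_abs_self _).trans ((ξ - z).le_opNorm v)
  have h3 := hz v
  nlinarith [mul_le_mul_of_nonneg_right h1 (norm_nonneg v)]

lemma F_tangent (hS : S.Standing) {r l : ℝ} (hr : 0 < r) (hl : 0 ≤ l) :
    S.F r + derivWithin S.F (Ici 0) r * (l - r) ≤ S.F l := by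
  have hd : DifferentiableWithinAt ℝ S.F (Ici 0) r :=
    (hS.F_contDiff.differentiableOn (by norm_num)) r hr.le
  rcases lt_trichotomy l r with h | h | h
  · have := hS.F_convex.slope_le_derivWithin hl hr.le h hd
    rw [slope_def_field, div_le_iff₀ (by linarith)] at this
    linarith
  · simp [h]
  · have := hS.F_convex.derivWithin_le_slope hr.le hl h hd
    rw [slope_def_field, le_div_iff₀ (by linarith)] at this
    linarith

/-- The slope of `F` runs continuously from `0` to `∞`. This is what lets a suitable `ε` realise any
prescribed weight of the norm. -/
lemma exists_F_deriv_eq (hS : S.Standing) {c : ℝ} (hc : 0 < c) :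
    ∃ r, 0 < r ∧ derivWithin S.F (Ici 0) r = c := by
  obtain ⟨R, hR, hR0⟩ := ((hS.F_deriv_tendsto.eventually_ge_atTop c).and
    (eventually_ge_atTop 0)).exists
  have hcont : ContinuousOn (derivWithin S.F (Ici 0)) (Icc 0 R) :=
    (hS.F_contDiff.continuousOn_derivWithin (uniqueDiffOn_Ici 0) le_rfl).mono Icc_subset_Ici_self
  obtain ⟨r, hr, hrc⟩ := intermediate_value_Icc hR0 hcont
    (⟨by rw [hS.F_deriv_zero]; exact hc.le, hR⟩ : c ∈ Icc _ _)
  refine ⟨r, lt_of_le_of_ne hr.1 ?_, hrc⟩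
  rintro rfl
  rw [hS.F_deriv_zero] at hrc
  exact hc.ne hrc

lemma F_nonneg (hS : S.Standing) {r : ℝ} (hr : 0 ≤ r) : 0 ≤ S.F r := by
  rcases hr.eq_or_lt with rfl | h
  · rw [hS.F_zero]
  · exact (hS.F_pos r h).le

lemma psi_le_viscous (hS : S.Standing) {ε : ℝ} (hε : 0 < ε) (v : V) : S.Ψ v ≤ S.viscous ε v :=
  le_add_of_nonneg_right (mul_nonneg (inv_nonneg.2 hε.le) (F_nonneg hS (norm_nonneg _)))

/-- Lower bound of the viscous dissipation by the rate-independent one. -/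
lemma le_viscous_add_viscousConj (hS : S.Standing) {t : ℝ} {u : V} {c ε : ℝ}
    (hε : 0 < ε) {ξ : V →L[ℝ] ℝ} (hξ : -ξ ∈ S.subdiff t u)
    (h : ENNReal.ofReal c ≤ S.instability t u) (v : V) :
    ENNReal.ofReal (S.Ψ v + c * ‖v‖) ≤ ENNReal.ofReal (S.viscous ε v) + S.viscousConj ε ξ := by
  have hvis := psi_le_viscous hS hε v
  have hP := hS.psi_nonneg v
  by_contra! hlt
  have htop : S.viscousConj ε ξ ≠ ⊤ := fun h => by simp [h] at hlt
  set K := (S.viscousConj ε ξ).toReal with hK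
  have hK0 : 0 ≤ K := ENNReal.toReal_nonneg
  rw [← ENNReal.ofReal_toReal htop, ← hK, ← ENNReal.ofReal_add (hP.trans hvis) hK0,
    ENNReal.ofReal_lt_ofReal_iff_of_nonneg (by linarith)] at hlt
  have hv : 0 < ‖v‖ := by
    by_contra! hv0
    have : ‖v‖ = 0 := le_antisymm hv0 (norm_nonneg v)
    rw [this] at hlt
    linarith
  -- The weight for which `Ψ v + c' ‖v‖` equals the viscous dissipation. It is below `c`, yet `key`
  -- will show that it bounds the instability.
  set c' := (S.viscous ε v + K - S.Ψ v) / ‖v‖ with hc'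
  have hc'0 : 0 ≤ c' := div_nonneg (by linarith) hv.le
  have hcc : c' < c := by rw [hc', div_lt_iff₀ hv]; linarith
  have key : ∀ w, ξ w ≤ S.Ψ w + c' * ‖w‖ := fun w => by
    rcases eq_or_ne w 0 with rfl | hw
    · simp [hS.isGauge.map_zero]
    have hw' : 0 < ‖w‖ := norm_pos_iff.2 hw
    -- The competitor is scaled to the norm of `v`, so its `F`-term is that of `v`, whatever `ε` is.
    set a := ‖v‖ / ‖w‖ with ha
    have ha0 : 0 < a := by positivity
    have hn : ‖ε • (a • w)‖ = ‖ε • v‖ := by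
      rw [norm_smul, norm_smul, norm_smul, Real.norm_of_nonneg ha0.le, ha,
        div_mul_cancel₀ _ hw'.ne']
    have h1 : ξ (a • w) - S.viscous ε (a • w) ≤ K := by
      refine (ENNReal.ofReal_le_iff_le_toReal htop).1 ?_
      exact le_iSup (fun v => ENNReal.ofReal (ξ v - S.viscous ε v)) (a • w)
    have h2 : S.viscous ε (a • w) = a * S.Ψ w + (S.viscous ε v - S.Ψ v) := by
      simp only [viscous, hn, hS.psi_homogeneous a w ha0.le]; ring
    rw [h2, map_smul, smul_eq_mul] at h1
    have h3 : c' * ‖v‖ = S.viscous ε v + K - S.Ψ v := by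
      rw [hc', div_mul_cancel₀ _ hv.ne']
    have h4 : a * ‖w‖ = ‖v‖ := by rw [ha, div_mul_cancel₀ _ hw'.ne']
    have h5 : a * ξ w ≤ a * (S.Ψ w + c' * ‖w‖) := by
      rw [mul_add, mul_left_comm, h4]; linarith
    exact le_of_mul_le_mul_left h5 ha0
  have h6 := h.trans (instability_le hS hc'0 hξ key)
  rw [ENNReal.ofReal_le_ofReal_iff hc'0] at h6
  linarith

lemma le_finsler (hS : S.Standing) {t : ℝ} {u : V} {c : ℝ}
    (h : ENNReal.ofReal c ≤ S.instability t u) (v : V) :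
    ENNReal.ofReal (S.Ψ v + c * ‖v‖) ≤ S.finsler t u v := by
  rw [finsler]
  split_ifs with hv
  · simp [hv, hS.isGauge.map_zero]
  · exact le_iInf₂ fun ξ hξ => le_iInf₂ fun ε hε => le_viscous_add_viscousConj hS hε hξ h v

lemma finsler_le (hS : S.Standing) {t : ℝ} {u : V} {c : ℝ}
    (h : S.instability t u < ENNReal.ofReal c) (v : V) :
    S.finsler t u v ≤ ENNReal.ofReal (S.Ψ v + c * ‖v‖) := by
  have hc : 0 < c := ENNReal.ofReal_pos.1 (bot_le.trans_lt h)
  rw [finsler]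
  split_ifs with hv
  · exact bot_le
  obtain ⟨ξ, hξ, hle⟩ := exists_of_instability_lt h
  obtain ⟨r, hr, hrc⟩ := exists_F_deriv_eq hS hc
  have hv' : 0 < ‖v‖ := norm_pos_iff.2 hv
  -- With `ε ‖v‖ = r`, where `F` has slope `c`, the Young inequality for `F` is an equality, and the
  -- two viscous contributions add up to `c ‖v‖`.
  have hε : 0 < r / ‖v‖ := by positivity
  refine (iInf₂_le_of_le ξ hξ (iInf₂_le (r / ‖v‖) hε)).trans ?_
  have hrF : S.F r ≤ c * r := by
    have := F_tangent hS hr le_rfl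
    rw [hrc, hS.F_zero] at this
    linarith
  have hinv : (r / ‖v‖)⁻¹ = ‖v‖ / r := inv_div _ _
  have hvis : S.viscous (r / ‖v‖) v = S.Ψ v + ‖v‖ / r * S.F r := by
    rw [viscous, norm_smul, Real.norm_of_nonneg hε.le, div_mul_cancel₀ _ hv'.ne', hinv]
  have hconj : S.viscousConj (r / ‖v‖) ξ ≤ ENNReal.ofReal (‖v‖ / r * (c * r - S.F r)) := by
    refine iSup_le fun w => ENNReal.ofReal_le_ofReal ?_
    have h1 := F_tangent hS hr (norm_nonneg ((r / ‖v‖) • w))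
    rw [hrc] at h1
    have h2 : ‖(r / ‖v‖) • w‖ = r / ‖v‖ * ‖w‖ := by rw [norm_smul, Real.norm_of_nonneg hε.le]
    rw [viscous, hinv]
    have h3 : ‖v‖ / r * (S.F r + c * (r / ‖v‖ * ‖w‖ - r)) =
        c * ‖w‖ - ‖v‖ / r * (c * r - S.F r) := by field_simp; ring
    rw [← h2] at h3
    have h4 := mul_le_mul_of_nonneg_left h1 (by positivity : 0 ≤ ‖v‖ / r)
    linarith [hle w]
  have hF := F_nonneg hS hr.le
  refine (add_le_add_right hconj _).trans ?_
  rw [hvis, ← ENNReal.ofReal_add (add_nonneg (hS.psi_nonneg v) (by positivity))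
    (mul_nonneg (by positivity) (by linarith))]
  refine ENNReal.ofReal_le_ofReal (le_of_eq ?_)
  field_simp; ring

end RISystem

/-! ### Energy levels, closedness of the subdifferential, semicontinuity of the instability. -/

namespace RISystem

lemma sublevel_mono {V : Type*} {S : RISystem V} {e e' : ℝ} (h : e ≤ e') :
    S.sublevel e ⊆ S.sublevel e' :=
  fun _ hu => ⟨hu.1, fun t ht => (hu.2 t ht).trans h⟩

variable {V : Type*} [NormedAddCommGroup V] [NormedSpace ℝ V] {S : RISystem V}

/-- Power control: a bound of the energy at one time controls the level. -/
lemma exists_level (hS : S.Standing) (M : ℝ) :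
    ∃ e : ℝ, 0 < e ∧ ∀ t ∈ Icc (0 : ℝ) S.T, ∀ v ∈ S.D, S.Ψ v + S.E t v ≤ M →
      v ∈ S.sublevel e := by
  obtain ⟨C, hC, hpow⟩ := hS.power_bound
  have hT := hS.T_pos
  refine ⟨Real.exp (C * S.T) * max M 0 + 1, by positivity, fun t ht v hv hM => ⟨hv, ?_⟩⟩
  set g : ℝ → ℝ := fun s => S.Ψ v + S.E s v with hg
  have hcont : ContinuousOn g (Icc 0 S.T) :=
    continuousOn_const.add (hS.E_differentiable v hv).continuousOn
  have hder : ∀ s ∈ Ioo (0 : ℝ) S.T, HasDerivAt g (S.power s v) s := fun s hs => by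
    have h1 := (hS.E_differentiable v hv s (Ioo_subset_Icc_self hs)).hasDerivWithinAt.hasDerivAt
      (Icc_mem_nhds hs.1 hs.2)
    exact h1.const_add _
  have hexp : ∀ a s : ℝ, HasDerivAt (fun s => Real.exp (a * s)) (Real.exp (a * s) * a) s :=
    fun a s => by simpa using ((hasDerivAt_id s).const_mul a).exp
  have hcexp : ∀ a : ℝ, ContinuousOn (fun s => Real.exp (a * s) * g s) (Icc 0 S.T) :=
    fun a => (by fun_prop : Continuous fun s => Real.exp (a * s)).continuousOn.mul hcont
  have hd : ∀ a : ℝ, ∀ s ∈ Ioo (0 : ℝ) S.T, HasDerivAt (fun s => Real.exp (a * s) * g s)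
      (Real.exp (a * s) * a * g s + Real.exp (a * s) * S.power s v) s :=
    fun a s hs => (hexp a s).mul (hder s hs)
  -- Gronwall in both time directions: this weight carries the bound forward from `t`, the weight in
  -- `hmono` backward.
  have hanti : AntitoneOn (fun s => Real.exp (-C * s) * g s) (Icc 0 S.T) := by
    refine antitoneOn_of_deriv_nonpos (convex_Icc _ _) (hcexp _) ?_ ?_
    · intro s hs
      rw [interior_Icc] at hs
      exact (hd (-C) s hs).differentiableAt.differentiableWithinAt
    · intro s hs
      rw [interior_Icc] at hs
      rw [(hd (-C) s hs).deriv]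
      have := (abs_le.1 (hpow s hs v hv)).2
      nlinarith [Real.exp_pos (-C * s), hpow s hs v hv]
  have hmono : MonotoneOn (fun s => Real.exp (C * s) * g s) (Icc 0 S.T) := by
    refine monotoneOn_of_deriv_nonneg (convex_Icc _ _) (hcexp _) ?_ ?_
    · intro s hs
      rw [interior_Icc] at hs
      exact (hd C s hs).differentiableAt.differentiableWithinAt
    · intro s hs
      rw [interior_Icc] at hs
      rw [(hd C s hs).deriv]
      have := (abs_le.1 (hpow s hs v hv)).1
      nlinarith [Real.exp_pos (C * s), hpow s hs v hv]
  have hmax : ∀ b : ℝ, b ≤ C * S.T → ∀ s : ℝ, g s ≤ Real.exp b * g t →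
      g s ≤ Real.exp (C * S.T) * max M 0 + 1 := fun b hb s hs => by
    have h1 : Real.exp b * g t ≤ Real.exp b * max M 0 :=
      mul_le_mul_of_nonneg_left (hM.trans (le_max_left _ _)) (Real.exp_pos _).le
    have h2 : Real.exp b * max M 0 ≤ Real.exp (C * S.T) * max M 0 :=
      mul_le_mul_of_nonneg_right (Real.exp_le_exp.2 hb) (le_max_right _ _)
    linarith
  intro s hs
  rcases le_total t s with h | h
  · refine hmax (C * (s - t)) (by nlinarith [hs.2, ht.1]) s ?_
    have h1 := mul_le_mul_of_nonneg_left (hanti ht hs h) (Real.exp_pos (C * s)).le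
    simp only [← mul_assoc, ← Real.exp_add] at h1
    calc g s = Real.exp (C * s + -C * s) * g s := by simp
      _ ≤ _ := h1
      _ = _ := by ring_nf
  · refine hmax (C * (t - s)) (by nlinarith [ht.2, hs.1]) s ?_
    have h1 := mul_le_mul_of_nonneg_left (hmono hs ht h) (Real.exp_pos (-C * s)).le
    simp only [← mul_assoc, ← Real.exp_add] at h1
    calc g s = Real.exp (-C * s + C * s) * g s := by simp
      _ ≤ _ := h1
      _ = _ := by ring_nf

/-- A lower bound on level sets of the energy that holds on large levels gives a subgradient. -/
lemma mem_subdiff_of_forall_sublevel (hS : S.Standing) {t : ℝ} (ht : t ∈ Icc (0 : ℝ) S.T) {u : V}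
    (hu : u ∈ S.D) {η : V →L[ℝ] ℝ}
    (h : ∀ e₀ : ℝ, ∃ e ≥ e₀, ∀ δ > 0, ∀ᶠ v in 𝓝[S.sublevel e] u,
      -(δ * ‖v - u‖) ≤ S.E t v - S.E t u - η (v - u)) :
    η ∈ S.subdiff t u := by
  refine ⟨hu, fun δ hδ => ?_⟩
  -- Points near `u` outside the sublevel have energy above `S.E t u + 2`, so the subgradient
  -- inequality is trivial there.
  obtain ⟨e₀, -, he₀⟩ := exists_level hS (S.Ψ u + 1 + (S.E t u + 2))
  obtain ⟨e, hee, he⟩ := h e₀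
  have h1 := eventually_nhdsWithin_iff.1 (he δ hδ)
  have h2 : ∀ᶠ v in 𝓝 u, S.Ψ v < S.Ψ u + 1 :=
    hS.psi_continuous.continuousAt.eventually_lt_const (by linarith)
  have h3 : ∀ᶠ v in 𝓝 u, η (v - u) < 1 := by
    have : Continuous fun v => η (v - u) := by fun_prop
    exact this.continuousAt.eventually_lt_const (by simp)
  refine eventually_nhdsWithin_iff.2 ?_
  filter_upwards [h1, h2, h3] with v hv1 hv2 hv3 hvD
  by_cases hv : v ∈ S.sublevel e
  · exact hv1 hv
  · have : S.E t u + 2 < S.E t v := by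
      by_contra! hcon
      exact hv (sublevel_mono hee (he₀ t ht v hvD (by linarith)))
    nlinarith [mul_nonneg hδ.le (norm_nonneg (v - u))]

/-- Strong-weak* closedness of the subdifferential on sublevels. -/
lemma neg_mem_subdiff_of_tendsto (hS : S.Standing) {e : ℝ} (he : 0 < e) {t : ℝ} {u : V}
    {ts : ℕ → ℝ} {us : ℕ → V} {ξs : ℕ → V →L[ℝ] ℝ} {ξ : V →L[ℝ] ℝ} {B : ℝ}
    (hts : ∀ n, ts n ∈ Icc (0 : ℝ) S.T) (hus : ∀ n, us n ∈ S.sublevel e)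
    (hξs : ∀ n, -ξs n ∈ S.subdiff (ts n) (us n)) (hB : ∀ n, ‖ξs n‖ ≤ B)
    (ht : Tendsto ts atTop (𝓝 t)) (hu : Tendsto us atTop (𝓝 u))
    (hξ : ∀ v, Tendsto (fun n => ξs n v) atTop (𝓝 (ξ v))) :
    -ξ ∈ S.subdiff t u := by
  have htI : t ∈ Icc (0 : ℝ) S.T := isClosed_Icc.mem_of_tendsto ht (Eventually.of_forall hts)
  have huE : u ∈ S.sublevel e :=
    (hS.E_coercive e he).isClosed.mem_of_tendsto hu (Eventually.of_forall hus)
  obtain ⟨L, hL, hΨL⟩ := hS.isGauge.exists_le_mul_norm hS.psi_continuous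
  refine mem_subdiff_of_forall_sublevel hS htI huE.1 fun e₀ => ?_
  have hE : e ≤ max e e₀ := le_max_left _ _
  -- The Fréchet condition is asymptotic and need not pass to limits. The inequality with `ω` holds
  -- on the whole sublevel, so it does; vanishing of `ω` on the diagonal then gives back a Fréchet
  -- subgradient.
  obtain ⟨ω, hω, hω0, hineq⟩ := hS.E_subdiff (max e e₀) (he.trans_le hE)
  refine ⟨max e e₀, le_max_right _ _, fun δ hδ => ?_⟩
  have hu' := sublevel_mono hE huE
  -- the limit inequality
  have key : ∀ v ∈ S.sublevel (max e e₀),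
      S.E t u + -ξ (v - u) - ω (t, u, v) * min (S.Ψ (v - u)) (S.Ψ (-(v - u))) ≤ S.E t v := by
    intro v hv
    have hm : ∀ x, 0 ≤ min (S.Ψ x) (S.Ψ (-x)) := fun x => le_min (hS.psi_nonneg _) (hS.psi_nonneg _)
    refine le_of_forall_pos_le_add fun η₀ hη₀ => ?_
    have hm1 : 0 < 1 + min (S.Ψ (v - u)) (S.Ψ (-(v - u))) := by linarith [hm (v - u)]
    obtain ⟨η, hη, hηη⟩ : ∃ η > 0, η * (1 + min (S.Ψ (v - u)) (S.Ψ (-(v - u)))) = η₀ :=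
      ⟨_, div_pos hη₀ hm1, div_mul_cancel₀ _ hm1.ne'⟩
    have hEv : Tendsto (fun n => S.E (ts n) v) atTop (𝓝 (S.E t v)) := by
      have := (hS.E_differentiable v hv.1).continuousOn t htI
      exact this.tendsto.comp (tendsto_nhdsWithin_iff.2 ⟨ht, Eventually.of_forall hts⟩)
    have hEu : ∀ᶠ n in atTop, S.E t u - η < S.E (ts n) (us n) := by
      have h1 := hS.E_lsc (t, u) ⟨htI, huE.1⟩ (S.E t u - η) (by simp [hη])
      exact (tendsto_nhdsWithin_iff.2 ⟨ht.prodMk_nhds hu,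
        Eventually.of_forall fun n => (⟨hts n, (hus n).1⟩ : (ts n, us n) ∈ _ ×ˢ _)⟩).eventually h1
    have hω' : ∀ᶠ n in atTop, ω (ts n, us n, v) < ω (t, u, v) + η := by
      have h1 := hω (t, u, v) ⟨htI, hu', hv⟩ (ω (t, u, v) + η) (by linarith)
      exact (tendsto_nhdsWithin_iff.2 ⟨ht.prodMk_nhds (hu.prodMk_nhds tendsto_const_nhds),
        Eventually.of_forall fun n =>
          (⟨hts n, sublevel_mono hE (hus n), hv⟩ : (ts n, us n, v) ∈ _ ×ˢ _ ×ˢ _)⟩).eventually h1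
    have hξu : Tendsto (fun n => ξs n (v - us n)) atTop (𝓝 (ξ (v - u))) := by
      have h1 : Tendsto (fun n => ξs n (u - us n)) atTop (𝓝 0) := by
        have h2 : Tendsto (fun n => B * ‖u - us n‖) atTop (𝓝 0) := by
          have := (tendsto_const_nhds (x := u)).sub hu
          simpa using this.norm.const_mul B
        refine squeeze_zero_norm (fun n => ((ξs n).le_opNorm _).trans ?_) h2
        exact mul_le_mul_of_nonneg_right (hB n) (norm_nonneg _)
      have h3 := (hξ (v - u)).add h1
      rw [add_zero] at h3
      refine h3.congr fun n => ?_
      rw [← map_add]; congr 1; abel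
    have hmt : Tendsto (fun n => min (S.Ψ (v - us n)) (S.Ψ (-(v - us n)))) atTop
        (𝓝 (min (S.Ψ (v - u)) (S.Ψ (-(v - u))))) := by
      have : Continuous fun x => min (S.Ψ (v - x)) (S.Ψ (-(v - x))) := by
        have := hS.psi_continuous
        fun_prop
      exact (this.tendsto u).comp hu
    have hle : ∀ᶠ n in atTop, (S.E t u - η) + -ξs n (v - us n) - (ω (t, u, v) + η) *
        min (S.Ψ (v - us n)) (S.Ψ (-(v - us n))) ≤ S.E (ts n) v := by
      filter_upwards [hEu, hω'] with n h1 h2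
      have h3 := hineq (ts n) (hts n) (us n) (sublevel_mono hE (hus n)) v hv _ (hξs n)
      rw [neg_apply] at h3
      nlinarith [mul_le_mul_of_nonneg_right h2.le (hm (v - us n))]
    have hlim := le_of_tendsto_of_tendsto
      ((tendsto_const_nhds.add hξu.neg).sub (tendsto_const_nhds.mul hmt)) hEv hle
    linarith
  have h0 : ∀ᶠ v in 𝓝[S.sublevel (max e e₀)] u, ω (t, u, v) < δ / L := by
    have h1 := hω (t, u, u) ⟨htI, hu', hu'⟩ (δ / L) (by
      simp only [hω0 t htI u hu']; positivity)
    refine (tendsto_nhdsWithin_iff.2 ⟨?_, ?_⟩ : Tendsto (fun v => (t, u, v)) _ _).eventually h1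
    · exact (Continuous.tendsto (by fun_prop : Continuous fun v : V => (t, u, v)) u).mono_left
        nhdsWithin_le_nhds
    · filter_upwards [self_mem_nhdsWithin] with v hv using ⟨htI, hu', hv⟩
  filter_upwards [h0, self_mem_nhdsWithin] with v hv1 hv
  have h1 := key v hv
  have h2 : 0 ≤ min (S.Ψ (v - u)) (S.Ψ (-(v - u))) := le_min (hS.psi_nonneg _) (hS.psi_nonneg _)
  have h3 : min (S.Ψ (v - u)) (S.Ψ (-(v - u))) ≤ L * ‖v - u‖ := (min_le_left _ _).trans (hΨL _)
  have h4 := mul_le_mul_of_nonneg_right hv1.le h2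
  have h5 := mul_le_mul_of_nonneg_left h3 (by positivity : 0 ≤ δ / L)
  have h6 : δ / L * (L * ‖v - u‖) = δ * ‖v - u‖ := by field_simp
  rw [neg_apply]
  linarith

/-- Joint lower semicontinuity of the instability function on sublevels. -/
lemma eventually_lt_instability [TopologicalSpace.SeparableSpace V] (hS : S.Standing) {e : ℝ}
    (he : 0 < e) {t : ℝ} {u : V} {c : ℝ} (hc : 0 ≤ c) (h : ENNReal.ofReal c < S.instability t u) :
    ∀ᶠ p in 𝓝[Icc (0 : ℝ) S.T ×ˢ S.sublevel e] (t, u), ENNReal.ofReal c < S.instability p.1 p.2 := by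
  by_contra hcon
  obtain ⟨p, hp, hpc⟩ := exists_seq_forall_of_frequently
    ((not_eventually.1 hcon).and_eventually self_mem_nhdsWithin)
  have hlim : Tendsto p atTop (𝓝 (t, u)) := tendsto_nhds_of_tendsto_nhdsWithin hp
  have hsel : ∀ n : ℕ, ∃ ξ : V →L[ℝ] ℝ, -ξ ∈ S.subdiff (p n).1 (p n).2 ∧
      ∀ v, ξ v ≤ S.Ψ v + (c + 1 / ((n : ℝ) + 1)) * ‖v‖ := fun n =>
    exists_of_instability_lt ((not_lt.1 (hpc n).1).trans_lt
      ((ENNReal.ofReal_lt_ofReal_iff (by positivity)).2 (by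
        have : (0 : ℝ) < 1 / ((n : ℝ) + 1) := by positivity
        linarith)))
  choose ξ hξ hξle using hsel
  obtain ⟨L, hL, hΨL⟩ := hS.isGauge.exists_le_mul_norm hS.psi_continuous
  have hB : ∀ n, ‖ξ n‖ ≤ L + (c + 1) := fun n => by
    have hn : 1 / ((n : ℝ) + 1) ≤ 1 := by
      rw [div_le_one (by positivity)]
      linarith [n.cast_nonneg (α := ℝ)]
    have hb : ∀ v, ξ n v ≤ (L + (c + 1)) * ‖v‖ := fun v => by
      nlinarith [hξle n v, hΨL v, mul_le_mul_of_nonneg_right hn (norm_nonneg v)]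
    refine ContinuousLinearMap.opNorm_le_bound _ (by linarith) fun v => ?_
    have h2 := hb (-v)
    rw [map_neg, norm_neg] at h2
    rw [Real.norm_eq_abs, abs_le]
    exact ⟨by linarith, hb v⟩
  -- Functionals below `Ψ + (c + 1) ‖·‖` are bounded, and separability makes dual balls weak*
  -- sequentially compact.
  obtain ⟨ξ₀, -, φ, hφ, hφlim⟩ := WeakDual.isSeqCompact_closedBall ℝ V 0 (L + (c + 1))
    (x := fun n => StrongDual.toWeakDual (ξ n)) (fun n => by simpa using hB n)
  have heval : ∀ v, Tendsto (fun n => ξ (φ n) v) atTop (𝓝 (ξ₀ v)) := fun v =>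
    ((WeakDual.eval_continuous v).tendsto ξ₀).comp hφlim
  have hpφ := hlim.comp hφ.tendsto_atTop
  have hmem := neg_mem_subdiff_of_tendsto hS he (ξ := WeakDual.toStrongDual ξ₀)
    (ξs := fun n => ξ (φ n)) (B := L + (c + 1)) (t := t) (u := u)
    (ts := fun n => (p (φ n)).1) (us := fun n => (p (φ n)).2)
    (fun n => (hpc (φ n)).2.1) (fun n => (hpc (φ n)).2.2) (fun n => hξ (φ n)) (fun n => hB _)
    ((continuous_fst.tendsto _).comp hpφ) ((continuous_snd.tendsto _).comp hpφ) heval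
  have hle : ∀ v, WeakDual.toStrongDual ξ₀ v ≤ S.Ψ v + c * ‖v‖ := fun v => by
    have h1 : Tendsto (fun n : ℕ => S.Ψ v + (c + 1 / ((φ n : ℝ) + 1)) * ‖v‖) atTop
        (𝓝 (S.Ψ v + (c + 0) * ‖v‖)) :=
      tendsto_const_nhds.add ((tendsto_const_nhds.add
        (tendsto_one_div_add_atTop_nhds_zero_nat.comp hφ.tendsto_atTop)).mul_const _)
    rw [add_zero] at h1
    exact le_of_tendsto_of_tendsto' (heval v) h1 fun n => hξle (φ n) v
  exact absurd (instability_le hS hc hmem hle) (not_le.2 h)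

/-- Uniform subdifferentiability estimate for the decrease of the energy, with a modulus `ω`. -/
lemma exists_energy_sub_le (hS : S.Standing) {e : ℝ} (he : 0 < e) {t : ℝ}
    (ht : t ∈ Icc (0 : ℝ) S.T) :
    ∃ (ω : V → V → ℝ) (W : ℝ), (∀ u v, 0 ≤ ω u v) ∧
      (∀ u ∈ S.sublevel e, ∀ v ∈ S.sublevel e, ω u v ≤ W) ∧
      (∀ u ∈ S.sublevel e, ∀ δ > 0, ∀ᶠ v in 𝓝[S.sublevel e] u, ω u v < δ) ∧
      ∀ u ∈ S.sublevel e, ∀ v ∈ S.sublevel e, ∀ c, S.instability t u < ENNReal.ofReal c →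
        S.E t u - S.E t v ≤ (1 + ω u v) * S.Ψ (v - u) + c * ‖v - u‖ := by
  obtain ⟨ω, hω, hω0, hineq⟩ := hS.E_subdiff e he
  have hK := hS.E_coercive e he
  obtain ⟨W, hW⟩ := hω.bddAbove_of_isCompact (isCompact_Icc.prod (hK.prod hK))
  -- With `ω` truncated at `0`, the minimum of the two gauges may be replaced by the larger `Ψ (v -
  -- u)`.
  refine ⟨fun u v => max (ω (t, u, v)) 0, max W 0, fun u v => le_max_right _ _,
    fun u hu v hv => max_le_max_right _ (hW ⟨(t, u, v), ⟨ht, hu, hv⟩, rfl⟩),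
    fun u hu δ hδ => ?_, fun u hu v hv c hc => ?_⟩
  · have h1 := hω (t, u, u) ⟨ht, hu, hu⟩ δ (by simp only [hω0 t ht u hu]; exact hδ)
    have h2 : ∀ᶠ v in 𝓝[S.sublevel e] u, ω (t, u, v) < δ := by
      refine (tendsto_nhdsWithin_iff.2 ⟨?_, ?_⟩ : Tendsto (fun v => (t, u, v)) _ _).eventually h1
      · exact (Continuous.tendsto (by fun_prop : Continuous fun v : V => (t, u, v)) u).mono_left
          nhdsWithin_le_nhds
      · filter_upwards [self_mem_nhdsWithin] with v hv using ⟨ht, hu, hv⟩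
    filter_upwards [h2] with v hv using max_lt hv hδ
  · obtain ⟨ξ, hξ, hle⟩ := exists_of_instability_lt hc
    have h1 := hineq t ht u hu v hv _ hξ
    have h2 := hle (v - u)
    have h3 : 0 ≤ min (S.Ψ (v - u)) (S.Ψ (-(v - u))) :=
      le_min (hS.psi_nonneg _) (hS.psi_nonneg _)
    have h4 := mul_le_mul_of_nonneg_right (le_max_left (ω (t, u, v)) 0) h3
    have h5 := mul_le_mul_of_nonneg_left (min_le_left (S.Ψ (v - u)) (S.Ψ (-(v - u))))
      (le_max_right (ω (t, u, v)) 0)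
    rw [neg_apply] at h1
    linarith

end RISystem

/-! ### Real-variable lemmas. -/

/-- A function whose decrease is controlled by an integral, and whose right lower slope is a.e.
at least `-q`, decreases at most by the integral of `q`. -/
lemma ofReal_sub_le_lintegral {f m : ℝ → ℝ} {a b K : ℝ} (hab : a ≤ b)
    (hm : IntervalIntegrable m volume a b)
    (hmono : ∀ x y, a ≤ x → x ≤ y → y ≤ b → f x - f y ≤ K * ∫ r in x..y, m r) {q : ℝ → ℝ≥0∞}
    (hq : ∀ᵐ s ∂(volume.restrict (Ioo a b)), ∀ c : ℝ, q s < ENNReal.ofReal c →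
      ∀ᶠ h in 𝓝[>] (0 : ℝ), f s - f (s + h) ≤ c * h) :
    ENNReal.ofReal (f a - f b) ≤ ∫⁻ s in Ioo a b, q s := by
  set I : ℝ → ℝ := fun x => ∫ r in a..x, m r with hI
  set g : ℝ → ℝ := fun x => f x + K * I x with hg
  have hgm : MonotoneOn g (uIcc a b) := by
    rw [uIcc_of_le hab]
    intro x hx y hy hxy
    have h1 := hmono x y hx.1 hxy hy.2
    have h2 : I y - I x = ∫ r in x..y, m r :=
      intervalIntegral.integral_interval_sub_left
        (hm.mono_set (by rw [uIcc_of_le hab, uIcc_of_le hy.1]; exact Icc_subset_Icc_right hy.2))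
        (hm.mono_set (by rw [uIcc_of_le hab, uIcc_of_le hx.1]; exact Icc_subset_Icc_right hx.2))
    rw [← h2] at h1
    simp only [hg]
    linarith
  -- A monotone function increases by at least the integral of its derivative; a singular part of
  -- `g` has the favourable sign.
  have hgi := hgm.intervalIntegrable_deriv
  have hgd : ∫ x in a..b, deriv g x ≤ g b - g a := by
    have h1 := hgm.intervalIntegral_deriv_mem_uIcc
    have h2 : g a ≤ g b := hgm left_mem_uIcc right_mem_uIcc hab
    rw [uIcc_of_le (by linarith)] at h1
    exact h1.2
  have hint : IntervalIntegrable (fun s => K * m s - deriv g s) volume a b :=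
    (hm.const_mul K).sub hgi
  have h1 : f a - f b ≤ ∫ s in a..b, (K * m s - deriv g s) := by
    rw [intervalIntegral.integral_sub (hm.const_mul K) hgi, intervalIntegral.integral_const_mul]
    simp only [hg, hI, intervalIntegral.integral_same, mul_zero, add_zero] at hgd
    linarith
  have hae : ∀ᵐ s ∂(volume.restrict (Ioo a b)), ENNReal.ofReal (K * m s - deriv g s) ≤ q s := by
    have e1 := ae_restrict_of_ae (s := Ioo a b) hgm.ae_differentiableWithinAt_of_mem
    have e2 := ae_restrict_of_ae (s := Ioo a b) hm.ae_hasDerivAt_integral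
    filter_upwards [e1, e2, hq, ae_restrict_mem measurableSet_Ioo] with s h1 h2 h3 hs
    rw [uIcc_of_le hab] at h1 h2
    have hsI := Ioo_subset_Icc_self hs
    have hdg : HasDerivAt g (deriv g s) s :=
      ((h1 hsI).differentiableAt (Icc_mem_nhds hs.1 hs.2)).hasDerivAt
    have hdI : HasDerivAt I (m s) s := h2 hsI a (left_mem_Icc.2 hab)
    have hdf : HasDerivAt f (deriv g s - K * m s) s := by
      have := hdg.sub (hdI.const_mul K)
      refine this.congr_of_eventuallyEq (Eventually.of_forall fun x => ?_)
      simp [hg]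
    by_contra! hlt
    obtain ⟨c, hc1, hc2⟩ := ENNReal.lt_iff_exists_nnreal_btwn.1 hlt
    rw [← ENNReal.ofReal_coe_nnreal] at hc1 hc2
    have h4 := h3 c hc1
    have h5 := (hasDerivAt_iff_tendsto_slope_zero.1 hdf).mono_left
      (nhdsWithin_mono (0 : ℝ) fun x (hx : x ∈ Ioi (0 : ℝ)) => ne_of_gt hx)
    have h6 : -(c : ℝ) ≤ deriv g s - K * m s := by
      refine ge_of_tendsto h5 ?_
      filter_upwards [h4, self_mem_nhdsWithin] with h hh (hpos : 0 < h)
      rw [smul_eq_mul, inv_mul_eq_div, le_div_iff₀ hpos]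
      linarith
    have h7 := (ENNReal.ofReal_lt_ofReal_iff'.1 hc2).1
    linarith
  refine (ENNReal.ofReal_le_ofReal h1).trans (le_trans ?_ (lintegral_mono_ae hae))
  rw [intervalIntegral.integral_of_le hab, integral_Ioc_eq_integral_Ioo,
    integral_eq_lintegral_pos_part_sub_lintegral_neg_part
      ((intervalIntegrable_iff_integrableOn_Ioo_of_le hab).1 hint)]
  exact (ENNReal.ofReal_le_ofReal (sub_le_self _ ENNReal.toReal_nonneg)).trans
    ENNReal.ofReal_toReal_le

/-- A real integrable minorant carrying the same integral on all subintervals. -/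
lemma exists_integrable_minorant {q : ℝ → ℝ≥0∞} {a b : ℝ} (hq : ∫⁻ r in Ioo a b, q r ≠ ⊤) :
    ∃ m : ℝ → ℝ, (∀ r, 0 ≤ m r) ∧ Integrable m ∧ (∀ r, ENNReal.ofReal (m r) ≤ q r) ∧
      ∀ x y, a ≤ x → x ≤ y → y ≤ b →
        ∫⁻ r in Ioo x y, q r = ENNReal.ofReal (∫ r in x..y, m r) := by
  -- No measurability of `q` is assumed: its lower integral is carried by a measurable minorant,
  -- simultaneously on all measurable subsets since the total is finite.
  obtain ⟨g, hg, hgq, hgi⟩ := exists_measurable_le_setLIntegral_eq_of_integrable hq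
  have hgtop : ∫⁻ r in Ioo a b, g r ≠ ⊤ :=
    ne_top_of_le_ne_top hq (lintegral_mono fun r => hgq r)
  have hint : IntegrableOn (fun r => (g r).toReal) (Ioo a b) :=
    integrable_toReal_of_lintegral_ne_top hg.aemeasurable hgtop
  have hm : Integrable ((Ioo a b).indicator fun r => (g r).toReal) :=
    hint.integrable_indicator measurableSet_Ioo
  have hnn : ∀ r, 0 ≤ (Ioo a b).indicator (fun r => (g r).toReal) r :=
    indicator_nonneg fun r _ => ENNReal.toReal_nonneg
  refine ⟨_, hnn, hm, fun r => ?_, fun x y hx hxy hy => ?_⟩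
  · by_cases hr : r ∈ Ioo a b
    · rw [indicator_of_mem hr]
      exact ENNReal.ofReal_toReal_le.trans (hgq r)
    · simp [indicator_of_notMem hr]
  · have hsub : Ioo x y ⊆ Ioo a b := Ioo_subset_Ioo hx hy
    have h1 := hgi (Ioo x y) measurableSet_Ioo
    rw [Measure.restrict_restrict measurableSet_Ioo, inter_eq_left.2 hsub] at h1
    rw [h1, intervalIntegral.integral_of_le hxy, integral_Ioc_eq_integral_Ioo,
      ofReal_integral_eq_lintegral_ofReal hm.integrableOn (Eventually.of_forall hnn)]
    refine lintegral_congr_ae ?_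
    have hlt := ae_mono (Measure.restrict_mono hsub le_rfl) (ae_lt_top hg hgtop)
    filter_upwards [hlt, ae_restrict_mem measurableSet_Ioo] with r hr hrm
    rw [indicator_of_mem (hsub hrm), ENNReal.ofReal_toReal hr.ne]

/-! ### Curves absolutely continuous with respect to a gauge. -/

lemma GaugeAC.mono {V : Type*} [AddCommGroup V] {M N : V → ℝ} {u : ℝ → V}
    {a b a' b' : ℝ} (h : GaugeAC M u a b) (ha : a ≤ a') (hb : b' ≤ b)
    {L : ℝ} (hL : 0 ≤ L) (hNM : ∀ v, N v ≤ L * M v) : GaugeAC N u a' b' := by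
  obtain ⟨m, hm0, hmi, hm⟩ := h
  refine ⟨fun r => L * m r, fun r => mul_nonneg hL (hm0 r),
    (hmi.mono_set (Icc_subset_Icc ha hb)).const_mul L, fun s t hs hst ht => ?_⟩
  rw [intervalIntegral.integral_const_mul]
  exact (hNM _).trans (mul_le_mul_of_nonneg_left (hm s t (ha.trans hs) hst (ht.trans hb)) hL)

section Gauge

variable {V : Type*} [NormedAddCommGroup V] [NormedSpace ℝ V] {N : V → ℝ}

lemma metricDeriv_of_differentiableAt (hc : Continuous N) {u : ℝ → V} {r : ℝ}
    (h : DifferentiableAt ℝ u r) :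
    metricDeriv N u r = ENNReal.ofReal (N (deriv u r)) := by
  have h1 := hasDerivAt_iff_tendsto_slope_zero.1 h.hasDerivAt
  exact (((ENNReal.continuous_ofReal.comp hc).tendsto _).comp h1).limsup_eq

lemma metricDeriv_le {u : ℝ → V} {r c : ℝ}
    (h : ∀ᶠ h in 𝓝[≠] (0 : ℝ), N (h⁻¹ • (u (r + h) - u r)) ≤ c) :
    metricDeriv N u r ≤ ENNReal.ofReal c :=
  limsup_le_of_le (by isBoundedDefault) (h.mono fun _ hh => ENNReal.ofReal_le_ofReal hh)

/-- The increments of an absolutely continuous curve are bounded by the integral of its metric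
derivative. -/
lemma IsGauge.ofReal_sub_le_lintegral_metricDeriv (hN : IsGauge N) {u : ℝ → V} {a b : ℝ}
    (hab : a ≤ b) (hu : GaugeAC N u a b) :
    ENNReal.ofReal (N (u b - u a)) ≤ ∫⁻ r in Ioo a b, metricDeriv N u r := by
  obtain ⟨m, hm0, hmi, hm⟩ := hu
  -- The gauge distance from the starting point reduces the vector-valued claim to the scalar lemma,
  -- with no differentiability of `u`.
  have htri : ∀ x y, - N (u x - u a) - - N (u y - u a) ≤ N (u y - u x) := fun x y => by
    linarith [hN.sub_le (u y) (u x) (u a)]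
  have key := ofReal_sub_le_lintegral (f := fun s => - N (u s - u a)) (m := m) (K := 1)
    (q := metricDeriv N u) hab
    ((intervalIntegrable_iff_integrableOn_Icc_of_le hab).2 hmi)
    (fun x y hx hxy hy => by rw [one_mul]; exact (htri x y).trans (hm x y hx hxy hy))
    (Eventually.of_forall fun s c hc => by
      have h1 := eventually_lt_of_limsup_lt (h := hc)
      have h2 : ∀ᶠ h in 𝓝[>] (0 : ℝ),
          ENNReal.ofReal (N (h⁻¹ • (u (s + h) - u s))) < ENNReal.ofReal c :=
        (nhdsWithin_mono (0 : ℝ) fun x (hx : 0 < x) => hx.ne') h1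
      filter_upwards [h2, self_mem_nhdsWithin] with h hh (hpos : 0 < h)
      refine (htri s (s + h)).trans ?_
      have h3 := (ENNReal.ofReal_lt_ofReal_iff'.1 hh).1
      rw [hN.smul_eq _ _ (inv_nonneg.2 hpos.le), inv_mul_eq_div, div_lt_iff₀ hpos] at h3
      exact h3.le)
  simpa [hN.map_zero] using key

end Gauge

/-- On a compact set, a positive gauge controls the norm of differences. -/
lemma exists_modulus_of_isCompact {V : Type*} [NormedAddCommGroup V] {N : V → ℝ}
    (hc : Continuous N) (hpos : ∀ v, v ≠ 0 → 0 < N v) {K : Set V} (hK : IsCompact K) {δ : ℝ}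
    (hδ : 0 < δ) : ∃ η > 0, ∀ x ∈ K, ∀ y ∈ K, N (y - x) < η → ‖y - x‖ < δ := by
  have hcl : IsCompact ((K ×ˢ K) ∩ {p : V × V | δ ≤ ‖p.2 - p.1‖}) :=
    (hK.prod hK).inter_right (isClosed_le continuous_const (by fun_prop))
  rcases ((K ×ˢ K) ∩ {p : V × V | δ ≤ ‖p.2 - p.1‖}).eq_empty_or_nonempty with h | h
  · refine ⟨1, one_pos, fun x hx y hy _ => ?_⟩
    by_contra! hcon
    exact (h ▸ (⟨⟨hx, hy⟩, hcon⟩ : (x, y) ∈ (K ×ˢ K) ∩ _) : (x, y) ∈ (∅ : Set (V × V)))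
  · obtain ⟨p, hp, hmin⟩ := hcl.exists_isMinOn h
      (by fun_prop : Continuous fun p : V × V => N (p.2 - p.1)).continuousOn
    refine ⟨N (p.2 - p.1), hpos _ fun h0 => ?_, fun x hx y hy hlt => ?_⟩
    · have := hp.2
      rw [mem_ofPred_eq, h0, norm_zero] at this
      linarith
    · by_contra! hcon
      exact absurd (hmin (⟨⟨hx, hy⟩, hcon⟩ : (x, y) ∈ (K ×ˢ K) ∩ _)) (not_le.2 hlt)

/-- The gauge may be much weaker than the norm; compactness of the range upgrades small gauge
increments to small norm increments. -/
lemma continuousOn_of_gaugeAC {V : Type*} [NormedAddCommGroup V] {N : V → ℝ}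
    (hc : Continuous N) (hpos : ∀ v, v ≠ 0 → 0 < N v) {K : Set V} (hK : IsCompact K)
    {u : ℝ → V} {a b : ℝ} (hu : GaugeAC N u a b) (huK : ∀ r ∈ Icc a b, u r ∈ K) :
    ContinuousOn u (Icc a b) := by
  obtain ⟨m, hm0, hmi, hm⟩ := hu
  have hI := intervalIntegral.continuousOn_primitive_interval (μ := volume) (f := m) (a := a) (b := b)
  intro r hr
  have hab : a ≤ b := hr.1.trans hr.2
  rw [uIcc_of_le hab] at hI
  have hint : IntervalIntegrable m volume a b :=
    (intervalIntegrable_iff_integrableOn_Icc_of_le hab).2 hmi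
  have hadd : ∀ x y, a ≤ x → x ≤ y → y ≤ b →
      N (u y - u x) ≤ (∫ s in a..y, m s) - ∫ s in a..x, m s := fun x y hx hxy hy => by
    rw [intervalIntegral.integral_interval_sub_left
      (hint.mono_set (by rw [uIcc_of_le hab, uIcc_of_le (hx.trans hxy)]
                         exact Icc_subset_Icc_right hy))
      (hint.mono_set (by rw [uIcc_of_le hab, uIcc_of_le hx]
                         exact Icc_subset_Icc_right (hxy.trans hy)))]
    exact hm x y hx hxy hy
  rw [ContinuousWithinAt, Metric.tendsto_nhds]
  intro δ hδ
  obtain ⟨η, hη, hmod⟩ := exists_modulus_of_isCompact hc hpos hK hδ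
  filter_upwards [Metric.tendsto_nhds.1 (hI hmi r hr) η hη, self_mem_nhdsWithin] with s hs hsI
  rw [Real.dist_eq, abs_lt] at hs
  rcases le_total s r with h | h
  · rw [dist_comm, dist_eq_norm]
    exact hmod _ (huK s hsI) _ (huK r hr) (by linarith [hadd s r hsI.1 h hr.2])
  · rw [dist_eq_norm]
    exact hmod _ (huK r hr) _ (huK s hsI) (by linarith [hadd r s hr.1 h hsI.2])

/-! ### The chain rule inequality for the energy along curves with a majorant. -/

namespace RISystem

variable {V : Type*} [NormedAddCommGroup V] [NormedSpace ℝ V] {S : RISystem V}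

lemma Standing.E_lsc_right (hS : S.Standing) {t : ℝ} (ht : t ∈ Icc (0 : ℝ) S.T) :
    LowerSemicontinuousOn (S.E t) S.D := by
  intro u hu y hy
  have h1 := hS.E_lsc (t, u) ⟨ht, hu⟩ y hy
  refine (tendsto_nhdsWithin_iff.2 ⟨?_, ?_⟩ : Tendsto (fun v => (t, v)) _ _).eventually h1
  · exact (Continuous.tendsto (by fun_prop : Continuous fun v : V => (t, v)) u).mono_left
      nhdsWithin_le_nhds
  · filter_upwards [self_mem_nhdsWithin] with v hv using ⟨ht, hv⟩

lemma eventually_lt_instability_comp [TopologicalSpace.SeparableSpace V] (hS : S.Standing) {e : ℝ}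
    (he : 0 < e) {t : ℝ} (ht : t ∈ Icc (0 : ℝ) S.T) {ϑ : ℝ → V} (hϑ : ContinuousOn ϑ (Icc 0 1))
    (hϑe : ∀ r ∈ Icc (0 : ℝ) 1, ϑ r ∈ S.sublevel e) {r : ℝ} (hr : r ∈ Icc (0 : ℝ) 1) {c : ℝ}
    (hc : 0 ≤ c) (h : ENNReal.ofReal c < S.instability t (ϑ r)) :
    ∀ᶠ s in 𝓝[Icc 0 1] r, ENNReal.ofReal c < S.instability t (ϑ s) := by
  have h1 := eventually_lt_instability hS he (t := t) (u := ϑ r) hc h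
  refine (tendsto_nhdsWithin_iff.2 ⟨?_, ?_⟩ : Tendsto (fun s => (t, ϑ s)) _ _).eventually h1
  · exact tendsto_const_nhds.prodMk_nhds (hϑ r hr)
  · filter_upwards [self_mem_nhdsWithin] with s hs using ⟨ht, hϑe s hs⟩

/-- `m` controls the increments of `ϑ` in `Ψ`, and in norm with the weight given by any lower bound
of the instability. -/
def IsMajorant (S : RISystem V) (t : ℝ) (ϑ : ℝ → V) (m : ℝ → ℝ) : Prop :=
  ∀ p q c : ℝ, 0 ≤ p → p ≤ q → q ≤ 1 → 0 ≤ c →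
    (∀ r ∈ Icc p q, ENNReal.ofReal c ≤ S.instability t (ϑ r)) →
      S.Ψ (ϑ q - ϑ p) + c * ‖ϑ q - ϑ p‖ ≤ ∫ r in p..q, m r

/-- The energy decreases along a majorized curve at most by a multiple of the majorant. -/
lemma IsMajorant.exists_energy_sub_le (hS : S.Standing) {e : ℝ} (he : 0 < e) {t : ℝ}
    (ht : t ∈ Icc (0 : ℝ) S.T) {ϑ : ℝ → V} (hϑ : ContinuousOn ϑ (Icc 0 1))
    (hϑe : ∀ r ∈ Icc (0 : ℝ) 1, ϑ r ∈ S.sublevel e) {m : ℝ → ℝ} (hm0 : ∀ r, 0 ≤ m r)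
    (hmi : Integrable m) (hm : S.IsMajorant t ϑ m) :
    ∃ K : ℝ, 0 ≤ K ∧ ∀ x y, 0 ≤ x → x ≤ y → y ≤ 1 →
      S.E t (ϑ x) - S.E t (ϑ y) ≤ K * ∫ r in x..y, m r := by
  obtain ⟨ω, W, hω0, hωW, -, hω⟩ := RISystem.exists_energy_sub_le hS he ht
  have hW : 0 ≤ W := (hω0 _ _).trans
    (hωW _ (hϑe 0 (by simp)) _ (hϑe 0 (by simp)))
  -- `1 + W` pays for the `Ψ`-part of the increments, `6` for the norm part of the dyadic chain.
  refine ⟨7 + W, by linarith, fun x y hx hxy hy => ?_⟩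
  have hsub : ∀ {s}, s ∈ Icc x y → s ∈ Icc (0 : ℝ) 1 := fun hs => ⟨hx.trans hs.1, hs.2.trans hy⟩
  -- it suffices to argue with a strictly positive density
  suffices H : ∀ κ > 0, S.E t (ϑ x) - S.E t (ϑ y) ≤ (7 + W) * ∫ r in x..y, (m r + κ) by
    refine le_of_forall_pos_le_add fun δ hδ => ?_
    have hpos : 0 < (7 + W) * (y - x + 1) := by
      have : 0 ≤ y - x := by linarith
      positivity
    have h1 := H (δ / ((7 + W) * (y - x + 1))) (by positivity)
    rw [intervalIntegral.integral_add hmi.intervalIntegrable (by simp),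
      intervalIntegral.integral_const, smul_eq_mul, mul_add] at h1
    have h2 : (7 + W) * ((y - x) * (δ / ((7 + W) * (y - x + 1)))) ≤ δ := by
      rw [← mul_assoc, mul_div_assoc', div_le_iff₀ hpos]
      nlinarith
    linarith
  intro κ hκ
  set J : ℝ → ℝ → ℝ := fun p q => ∫ r in p..q, (m r + κ) with hJ
  have hii : ∀ p q, IntervalIntegrable (fun r => m r + κ) volume p q :=
    fun p q => hmi.intervalIntegrable.add (by simp)
  have hJadd : ∀ p q r, J p q + J q r = J p r := fun p q r =>
    intervalIntegral.integral_add_adjacent_intervals (hii p q) (hii q r)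
  have hmJ : ∀ p q, p ≤ q → (∫ r in p..q, m r) + κ * (q - p) ≤ J p q := fun p q hpq => by
    simp only [hJ]
    rw [intervalIntegral.integral_add hmi.intervalIntegrable (by simp),
      intervalIntegral.integral_const, smul_eq_mul, mul_comm κ]
  have hm0' : ∀ p q, p ≤ q → 0 ≤ ∫ r in p..q, m r := fun p q hpq =>
    intervalIntegral.integral_nonneg hpq fun r _ => hm0 r
  have hJ0 : ∀ p q, p ≤ q → 0 ≤ J p q := fun p q hpq => by
    have := mul_nonneg hκ.le (sub_nonneg.2 hpq)
    linarith [hmJ p q hpq, hm0' p q hpq]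
  -- A direct comparison of `x` with `y` fails if the instability at `ϑ x` is infinite. The chain
  -- runs instead through points of controlled instability whose distance from `ϑ x` is halved at
  -- each step.
  set ρ : ℝ → ℝ := fun s => ‖ϑ s - ϑ x‖ with hρ
  have hρc : ContinuousOn ρ (Icc x y) :=
    ((hϑ.mono fun s hs => hsub hs).sub continuousOn_const).norm
  obtain ⟨z₀, hz₀, hmax⟩ := isCompact_Icc.exists_isMaxOn (nonempty_Icc.2 hxy) hρc
  set R := ρ z₀ with hR
  have hρR : ∀ s ∈ Icc x y, ρ s ≤ R := fun s hs => hmax hs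
  rcases (norm_nonneg (ϑ z₀ - ϑ x)).eq_or_lt with h0 | hRpos
  · have h1 : ϑ y = ϑ x := by
      have h2 := hρR y (right_mem_Icc.2 hxy)
      have h3 : ρ y = 0 := le_antisymm (by rw [hR, hρ] at h2; simp only at h2; linarith)
        (norm_nonneg _)
      exact sub_eq_zero.1 (norm_eq_zero.1 h3)
    rw [h1, sub_self]
    exact mul_nonneg (by linarith) (hJ0 x y hxy)
  -- first times at which a given distance is reached
  have hfirst : ∀ l : ℝ, ∃ p, 0 < l → l ≤ R →
      p ∈ Icc x y ∧ ρ p = l ∧ ∀ s ∈ Icc x y, s < p → ρ s < l := by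
    intro l
    by_cases hl : 0 < l ∧ l ≤ R
    · have hcl : IsCompact (Icc x y ∩ {s | l ≤ ρ s}) := by
        have : IsClosed (Icc x y ∩ ρ ⁻¹' Ici l) :=
          hρc.preimage_isClosed_of_isClosed isClosed_Icc isClosed_Ici
        exact isCompact_Icc.of_isClosed_subset this inter_subset_left
      have hmem := hcl.sInf_mem ⟨z₀, hz₀, hl.2⟩
      set p := sInf (Icc x y ∩ {s | l ≤ ρ s}) with hp
      have hlow : ∀ s ∈ Icc x y, s < p → ρ s < l := fun s hs hsp => by
        by_contra! hcon
        exact absurd (csInf_le hcl.bddBelow ⟨hs, hcon⟩) (not_le.2 hsp)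
      refine ⟨p, fun _ _ => ⟨hmem.1, ?_, hlow⟩⟩
      obtain ⟨s, hs, hsl⟩ := intermediate_value_Icc hmem.1.1
        (hρc.mono (Icc_subset_Icc_right hmem.1.2)) (⟨by simp [hρ, hl.1.le], hmem.2⟩ : l ∈ Icc _ _)
      rcases hs.2.eq_or_lt with h | h
      · rw [← h]; exact hsl
      · exact absurd hsl (hlow s ⟨hs.1, hs.2.trans hmem.1.2⟩ h).ne
    · exact ⟨0, fun h1 h2 => absurd ⟨h1, h2⟩ hl⟩
  choose P hP using hfirst
  -- a step of the chain
  have hstep : ∀ l, 0 < l → l ≤ R → ∀ z ∈ Icc x y, P l ≤ z → ρ z ≤ 2 * l →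
      ∃ r ∈ Icc x y, P (l / 2) ≤ r ∧ r ≤ z ∧ ρ r ≤ l ∧ P (l / 2) ≤ P l ∧
        S.E t (ϑ r) - S.E t (ϑ z) ≤ (1 + W) * J r z + 6 * J (P (l / 2)) (P l) := by
    intro l hl hlR z hz hPz hρz
    obtain ⟨h1, h1', h1''⟩ := hP l hl hlR
    obtain ⟨h2, h2', h2''⟩ := hP (l / 2) (by linarith) (by linarith)
    have hlt : P (l / 2) < P l := by
      by_contra! hcon
      rcases hcon.eq_or_lt with h | h
      · rw [h, h2'] at h1'; linarith
      · have := h2'' _ h1 h; linarith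
    -- Between these first hitting times the curve moves by at least `l / 2`, so an instability
    -- everywhere at least `c` would force `∫ m ≥ J`; the extra `κ` makes that a contradiction.
    set c := 2 * J (P (l / 2)) (P l) / l with hc
    have hc0 : 0 ≤ c := div_nonneg (mul_nonneg zero_le_two (hJ0 _ _ hlt.le)) hl.le
    obtain ⟨r, hr, hrc⟩ : ∃ r ∈ Icc (P (l / 2)) (P l), S.instability t (ϑ r) < ENNReal.ofReal c := by
      by_contra! hcon
      have h3 := hm _ _ c (hsub h2).1 hlt.le (hsub h1).2 hc0 hcon
      have h4 : l / 2 ≤ ‖ϑ (P l) - ϑ (P (l / 2))‖ := by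
        have h5 := norm_sub_norm_le (ϑ (P l) - ϑ x) (ϑ (P (l / 2)) - ϑ x)
        rw [sub_sub_sub_cancel_right] at h5
        simp only [hρ] at h1' h2'
        linarith
      have h5 : c * (l / 2) = J (P (l / 2)) (P l) := by rw [hc]; field_simp
      have h6 := mul_le_mul_of_nonneg_left h4 hc0
      have h7 := hmJ _ _ hlt.le
      have h8 := mul_pos hκ (sub_pos.2 hlt)
      have h9 := hS.psi_nonneg (ϑ (P l) - ϑ (P (l / 2)))
      linarith
    have hrI : r ∈ Icc x y := ⟨h2.1.trans hr.1, hr.2.trans h1.2⟩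
    have hrz : r ≤ z := hr.2.trans hPz
    have hρr : ρ r ≤ l := by
      rcases hr.2.eq_or_lt with h | h
      · rw [h, h1']
      · exact (h1'' r hrI h).le
    refine ⟨r, hrI, hr.1, hrz, hρr, hlt.le, ?_⟩
    have h3 := hω _ (hϑe r (hsub hrI)) _ (hϑe z (hsub hz)) c hrc
    have h4 : S.Ψ (ϑ z - ϑ r) ≤ J r z := by
      have h5 := hm r z 0 (hsub hrI).1 hrz (hsub hz).2 le_rfl (by simp)
      have h6 := hmJ r z hrz
      have h7 := mul_nonneg hκ.le (sub_nonneg.2 hrz)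
      linarith
    have h5 : (1 + ω (ϑ r) (ϑ z)) * S.Ψ (ϑ z - ϑ r) ≤ (1 + W) * J r z :=
      mul_le_mul (by linarith [hωW _ (hϑe r (hsub hrI)) _ (hϑe z (hsub hz))]) h4
        (hS.psi_nonneg _) (by linarith)
    have h6 : ‖ϑ z - ϑ r‖ ≤ 3 * l := by
      have h7 := norm_sub_le (ϑ z - ϑ x) (ϑ r - ϑ x)
      rw [sub_sub_sub_cancel_right] at h7
      simp only [hρ] at hρz hρr
      linarith
    have h7 := mul_le_mul_of_nonneg_left h6 hc0
    have h8 : c * (3 * l) = 6 * J (P (l / 2)) (P l) := by rw [hc]; field_simp; ring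
    linarith
  -- The intervals between consecutive first hitting times are adjacent, so the errors `6 J`
  -- telescope and do not depend on the number of steps.
  have hchain : ∀ k : ℕ, ∃ z ∈ Icc x y, P (R / 2 ^ k) ≤ z ∧ ρ z ≤ 2 * (R / 2 ^ k) ∧
      S.E t (ϑ z) - S.E t (ϑ y) ≤ (1 + W) * J z y + 6 * J (P (R / 2 ^ k)) y := by
    intro k
    induction k with
    | zero =>
      simp only [pow_zero, div_one]
      have h1 := (hP R hRpos le_rfl).1
      refine ⟨y, right_mem_Icc.2 hxy, h1.2, ?_, ?_⟩
      · have := hρR y (right_mem_Icc.2 hxy)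
        linarith [show 0 < R from hRpos]
      · have h2 : J y y = 0 := intervalIntegral.integral_same
        have h3 := hJ0 _ _ h1.2
        rw [h2]
        linarith
    | succ k ih =>
      obtain ⟨z, hz, hPz, hρz, hEz⟩ := ih
      have hl : 0 < R / 2 ^ k := div_pos hRpos (by positivity)
      have hlR : R / 2 ^ k ≤ R := div_le_self hRpos.le (one_le_pow₀ one_le_two)
      obtain ⟨r, hr, hPr, hrz, hρr, hPP, hE⟩ := hstep _ hl hlR z hz hPz hρz
      have hk : R / 2 ^ (k + 1) = R / 2 ^ k / 2 := by rw [pow_succ, div_div]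
      rw [hk]
      refine ⟨r, hr, hPr, by linarith, ?_⟩
      have h1 := hJadd r z y
      have h2 := hJadd (P (R / 2 ^ k / 2)) (P (R / 2 ^ k)) y
      have h3 : (1 + W) * J r y = (1 + W) * J r z + (1 + W) * J z y := by rw [← h1]; ring
      linarith
  choose z hz hPz hρz hEz using hchain
  -- Only the states converge; the times `z k` need not tend to `x`. Lower semicontinuity of the
  -- energy at `ϑ x` is then enough.
  have hlim : Tendsto (fun k => ϑ (z k)) atTop (𝓝 (ϑ x)) := by
    rw [tendsto_iff_norm_sub_tendsto_zero]
    refine squeeze_zero (fun k => norm_nonneg _) hρz ?_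
    have : Tendsto (fun k : ℕ => 2 * (R * (1 / 2 : ℝ) ^ k)) atTop (𝓝 (2 * (R * 0))) :=
      ((tendsto_pow_atTop_nhds_zero_of_lt_one (by norm_num) (by norm_num)).const_mul R).const_mul 2
    simpa [div_eq_mul_inv] using this
  refine le_of_forall_pos_le_add fun δ hδ => ?_
  have h1 := hS.E_lsc_right ht (ϑ x) (hϑe x (hsub (left_mem_Icc.2 hxy))).1 (S.E t (ϑ x) - δ)
    (by linarith)
  obtain ⟨k, hk⟩ := ((tendsto_nhdsWithin_iff.2 ⟨hlim, Eventually.of_forall fun k =>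
    (hϑe (z k) (hsub (hz k))).1⟩).eventually h1).exists
  have hR2 : 0 < R / 2 ^ k := div_pos hRpos (by positivity)
  have hP2 := (hP (R / 2 ^ k) hR2 (div_le_self hRpos.le (one_le_pow₀ one_le_two))).1
  have h2 : (1 + W) * J (z k) y ≤ (1 + W) * J x y :=
    mul_le_mul_of_nonneg_left (by linarith [hJadd x (z k) y, hJ0 x (z k) (hz k).1]) (by linarith)
  have h3 : J (P (R / 2 ^ k)) y ≤ J x y := by linarith [hJadd x (P (R / 2 ^ k)) y, hJ0 x _ hP2.1]
  have h4 := hEz k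
  change S.E t (ϑ x) - S.E t (ϑ y) ≤ (7 + W) * J x y + δ
  linarith

lemma eventually_forall_Icc {P : ℝ → Prop} {s : ℝ} (h : ∀ᶠ r in 𝓝 s, P r) :
    ∀ᶠ h in 𝓝[>] (0 : ℝ), ∀ r ∈ Icc s (s + h), P r := by
  obtain ⟨δ, hδ, hb⟩ := Metric.eventually_nhds_iff.1 h
  filter_upwards [Ioo_mem_nhdsGT hδ] with h hh r hr
  refine hb ?_
  rw [Real.dist_eq, abs_of_nonneg (by linarith [hr.1])]
  linarith [hr.2, hh.2]

/-- The chain rule inequality along a curve with a majorant below its cost density. -/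
lemma IsMajorant.energy_sub_le [TopologicalSpace.SeparableSpace V] (hS : S.Standing) {e : ℝ}
    (he : 0 < e) {t : ℝ} (ht : t ∈ Icc (0 : ℝ) S.T) {ϑ : ℝ → V} (hϑ : ContinuousOn ϑ (Icc 0 1))
    (hϑe : ∀ r ∈ Icc (0 : ℝ) 1, ϑ r ∈ S.sublevel e) {m : ℝ → ℝ} (hm0 : ∀ r, 0 ≤ m r)
    (hmi : Integrable m) (hm : S.IsMajorant t ϑ m)
    (hmle : ∀ r, ENNReal.ofReal (m r) ≤ S.costDensity t ϑ r) {a : ℝ} (ha : 0 ≤ a) (ha1 : a ≤ 1) :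
    S.E t (ϑ a) - S.E t (ϑ 1) ≤ ∫ r in a..1, m r := by
  obtain ⟨K, hK, hrough⟩ := hm.exists_energy_sub_le hS he ht hϑ hϑe hm0 hmi
  obtain ⟨ω, W, hω0, hωW, hωlim, hω⟩ := RISystem.exists_energy_sub_le hS he ht
  have hfin : ENNReal.ofReal (S.E t (ϑ a) - S.E t (ϑ 1)) ≤
      ∫⁻ r in Ioo a 1, ENNReal.ofReal (m r) := by
    refine ofReal_sub_le_lintegral (f := fun s => S.E t (ϑ s)) ha1 hmi.intervalIntegrable
      (fun x y hx hxy hy => hrough x y (ha.trans hx) hxy hy) ?_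
    have hae := ae_restrict_of_ae (s := Ioo a 1)
      (hmi.intervalIntegrable (a := a) (b := 1)).ae_hasDerivAt_integral
    filter_upwards [hae, ae_restrict_mem measurableSet_Ioo] with s hs hsI c hc
    have hs01 : s ∈ Ioo (0 : ℝ) 1 := ⟨ha.trans_lt hsI.1, hsI.2⟩
    have hsI' := Ioo_subset_Icc_self hs01
    have hnhds : Icc (0 : ℝ) 1 ∈ 𝓝 s := Icc_mem_nhds hs01.1 hs01.2
    have hc' : m s < c := (ENNReal.ofReal_lt_ofReal_iff'.1 hc).1
    have hIcc : ∀ᶠ h in 𝓝[>] (0 : ℝ), ∀ r ∈ Icc s (s + h), r ∈ Icc (0 : ℝ) 1 :=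
      eventually_forall_Icc hnhds
    -- `s` is a differentiability point of the primitive of `m`
    have hleb : ∀ c', m s < c' → ∀ᶠ h in 𝓝[>] (0 : ℝ), ∫ r in s..s + h, m r ≤ c' * h := by
      intro c' hc'
      rw [uIcc_of_le ha1] at hs
      have h1 := (hasDerivAt_iff_tendsto_slope_zero.1
        (hs (Ioo_subset_Icc_self hsI) a (left_mem_Icc.2 ha1))).mono_left
        (nhdsWithin_mono (0 : ℝ) fun x (hx : x ∈ Ioi (0 : ℝ)) => ne_of_gt hx)
      filter_upwards [h1.eventually_lt_const hc', self_mem_nhdsWithin] with h hh (hpos : 0 < h)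
      rw [intervalIntegral.integral_interval_sub_left hmi.intervalIntegrable
        hmi.intervalIntegrable, smul_eq_mul, inv_mul_eq_div, div_lt_iff₀ hpos] at hh
      exact hh.le
    have hfar : ∀ c₀ : ℝ, 0 ≤ c₀ → ENNReal.ofReal c₀ < S.instability t (ϑ s) →
        ∀ᶠ h in 𝓝[>] (0 : ℝ),
          S.Ψ (ϑ (s + h) - ϑ s) + c₀ * ‖ϑ (s + h) - ϑ s‖ ≤ ∫ r in s..s + h, m r := by
      intro c₀ hc₀ hlt
      have h1 := eventually_lt_instability_comp hS he ht hϑ hϑe hsI' hc₀ hlt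
      rw [nhdsWithin_eq_nhds.2 hnhds] at h1
      filter_upwards [eventually_forall_Icc h1, hIcc, self_mem_nhdsWithin] with h h2 h3
        (hpos : 0 < h)
      exact hm s (s + h) c₀ hsI'.1 (by linarith) (h3 _ (right_mem_Icc.2 (by linarith))).2 hc₀
        fun r hr => (h2 r hr).le
    -- Where the instability is infinite the subgradient estimate says nothing. But then `m s = 0`,
    -- since a nonzero derivative would violate the majorant inequality for large weights, and the
    -- crude constant `K` does no harm.
    rcases eq_or_ne (S.instability t (ϑ s)) ⊤ with htop | htop
    · have hms : m s = 0 := by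
        have hG : s ∈ S.unstableTimes t ϑ := ⟨hsI', by rw [htop]; exact ENNReal.zero_lt_top⟩
        have h1 := hmle s
        rw [costDensity, if_pos hG] at h1
        by_cases hd : deriv ϑ s = 0
        · rw [finsler, if_pos hd] at h1
          exact le_antisymm (ENNReal.ofReal_eq_zero.1 (le_antisymm h1 bot_le)) (hm0 s)
        · exfalso
          have hdd := (differentiableAt_of_deriv_ne_zero hd).hasDerivAt
          have hn : 0 < ‖deriv ϑ s‖ := norm_pos_iff.2 hd
          have h2 := ((hasDerivAt_iff_tendsto_slope_zero.1 hdd).mono_left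
            (nhdsWithin_mono (0 : ℝ) fun x (hx : x ∈ Ioi (0 : ℝ)) => ne_of_gt hx)).norm
          set c₀ := (m s + 2) / ‖deriv ϑ s‖ with hc₀
          have hc₀0 : 0 ≤ c₀ := div_nonneg (by linarith [hm0 s]) hn.le
          have h3 : c₀ * ‖deriv ϑ s‖ ≤ m s + 1 := by
            refine le_of_tendsto (h2.const_mul c₀) ?_
            filter_upwards [hfar c₀ hc₀0 (by rw [htop]; exact ENNReal.ofReal_lt_top),
              hleb (m s + 1) (by linarith), self_mem_nhdsWithin] with h h4 h5 (hpos : 0 < h)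
            rw [norm_smul, norm_inv, Real.norm_of_nonneg hpos.le, mul_left_comm, inv_mul_eq_div,
              div_le_iff₀ hpos]
            linarith [hS.psi_nonneg (ϑ (s + h) - ϑ s)]
          rw [hc₀, div_mul_cancel₀ _ hn.ne'] at h3
          linarith
      have hK1 : 0 < K + 1 := by linarith
      have hc0 : 0 < c := by linarith
      filter_upwards [hleb (c / (K + 1)) (by rw [hms]; positivity), hIcc,
        self_mem_nhdsWithin] with h h1 h2 (hpos : 0 < h)
      have h3 := hrough s (s + h) hsI'.1 (by linarith) (h2 _ (right_mem_Icc.2 (by linarith))).2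
      have h4 := mul_le_mul_of_nonneg_left h1 hK
      have h5 : K * (c / (K + 1) * h) ≤ c * h := by
        rw [← mul_assoc, mul_div_assoc', div_mul_eq_mul_div, div_le_iff₀ hK1]
        nlinarith [mul_pos hc0 hpos]
      linarith
    · -- the stable case and the unstable case with finite instability
      obtain ⟨θ, hθ1, hθc⟩ : ∃ θ : ℝ, 1 < θ ∧ m s * θ ^ 2 < c := by
        have h1 : Tendsto (fun θ : ℝ => m s * θ ^ 2) (𝓝[>] 1) (𝓝 (m s * 1 ^ 2)) :=
          ((by fun_prop : Continuous fun θ : ℝ => m s * θ ^ 2).tendsto 1).mono_left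
            nhdsWithin_le_nhds
        obtain ⟨θ, h2, h3⟩ := ((h1.eventually_lt_const (by simpa using hc')).and
          self_mem_nhdsWithin).exists
        exact ⟨θ, h3, h2⟩
      have hθ0 : 0 < θ := by linarith
      have hωs : ∀ᶠ h in 𝓝[>] (0 : ℝ), 1 + ω (ϑ s) (ϑ (s + h)) ≤ θ := by
        have h1 : Tendsto (fun h : ℝ => s + h) (𝓝[>] 0) (𝓝 s) := by
          have h2 := (continuous_const_add s).tendsto (0 : ℝ)
          rw [add_zero] at h2
          exact h2.mono_left nhdsWithin_le_nhds
        have h2 : Tendsto (fun h : ℝ => ϑ (s + h)) (𝓝[>] 0) (𝓝[S.sublevel e] (ϑ s)) := by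
          refine tendsto_nhdsWithin_iff.2
            ⟨(hϑ.continuousAt hnhds).tendsto.comp h1, ?_⟩
          filter_upwards [h1.eventually hnhds] with h hh using hϑe _ hh
        filter_upwards [h2.eventually (hωlim _ (hϑe s hsI') (θ - 1) (by linarith))] with h hh
        linarith
      have hcθ : ∀ᶠ h in 𝓝[>] (0 : ℝ), θ ^ 2 * ∫ r in s..s + h, m r ≤ c * h := by
        filter_upwards [hleb (c / θ ^ 2) (by rwa [lt_div_iff₀ (by positivity)])] with h hh
        have := mul_le_mul_of_nonneg_left hh (by positivity : 0 ≤ θ ^ 2)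
        rwa [← mul_assoc, mul_div_cancel₀ _ (by positivity)] at this
      rcases eq_or_ne (S.instability t (ϑ s)) 0 with hz | hz
      · filter_upwards [hωs, hcθ, hIcc, self_mem_nhdsWithin] with h h1 h2 h3 (hpos : 0 < h)
        have hsh := h3 _ (right_mem_Icc.2 (by linarith))
        have h4 := hm s (s + h) 0 hsI'.1 (by linarith) hsh.2 le_rfl (by simp)
        rw [zero_mul, add_zero] at h4
        have h5 : S.E t (ϑ s) - S.E t (ϑ (s + h)) ≤
            (1 + ω (ϑ s) (ϑ (s + h))) * S.Ψ (ϑ (s + h) - ϑ s) := by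
          refine le_of_forall_pos_le_add fun δ hδ => ?_
          have hn : 0 < ‖ϑ (s + h) - ϑ s‖ + 1 := by positivity
          have h6 := hω _ (hϑe s hsI') _ (hϑe _ hsh) (δ / (‖ϑ (s + h) - ϑ s‖ + 1))
            (by rw [hz]; exact ENNReal.ofReal_pos.2 (by positivity))
          have h7 : δ / (‖ϑ (s + h) - ϑ s‖ + 1) * ‖ϑ (s + h) - ϑ s‖ ≤ δ := by
            rw [div_mul_eq_mul_div, div_le_iff₀ hn]
            nlinarith
          linarith
        have h6 := mul_le_mul h1 h4 (hS.psi_nonneg _) hθ0.le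
        have h7 : 0 ≤ ∫ r in s..s + h, m r := (hS.psi_nonneg _).trans h4
        have h8 : θ * ∫ r in s..s + h, m r ≤ θ ^ 2 * ∫ r in s..s + h, m r :=
          mul_le_mul_of_nonneg_right (by nlinarith) h7
        linarith
      · set i := (S.instability t (ϑ s)).toReal with hi
        have hi0 : 0 < i := ENNReal.toReal_pos hz htop
        have hii : S.instability t (ϑ s) = ENNReal.ofReal i := (ENNReal.ofReal_toReal htop).symm
        filter_upwards [hωs, hcθ, hIcc, self_mem_nhdsWithin, hfar (i / θ) (by positivity)
          (by rw [hii, ENNReal.ofReal_lt_ofReal_iff hi0, div_lt_iff₀ hθ0]; nlinarith)]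
          with h h1 h2 h3 (hpos : 0 < h) h4
        have hsh := h3 _ (right_mem_Icc.2 (by linarith))
        have h5 := hω _ (hϑe s hsI') _ (hϑe _ hsh) (i * θ)
          (by rw [hii, ENNReal.ofReal_lt_ofReal_iff (by positivity)]; nlinarith)
        have h6 := mul_le_mul_of_nonneg_right h1 (hS.psi_nonneg (ϑ (s + h) - ϑ s))
        have h7 := mul_le_mul_of_nonneg_left h4 (by positivity : 0 ≤ θ ^ 2)
        have h8 : θ ^ 2 * (S.Ψ (ϑ (s + h) - ϑ s) + i / θ * ‖ϑ (s + h) - ϑ s‖) =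
            θ ^ 2 * S.Ψ (ϑ (s + h) - ϑ s) + i * θ * ‖ϑ (s + h) - ϑ s‖ := by
          field_simp
        have h9 : θ * S.Ψ (ϑ (s + h) - ϑ s) ≤ θ ^ 2 * S.Ψ (ϑ (s + h) - ϑ s) :=
          mul_le_mul_of_nonneg_right (by nlinarith) (hS.psi_nonneg _)
        linarith
  rw [← ofReal_integral_eq_lintegral_ofReal hmi.integrableOn (Eventually.of_forall hm0),
    ← integral_Ioc_eq_integral_Ioo, ← intervalIntegral.integral_of_le ha1] at hfin
  exact (ENNReal.ofReal_le_ofReal_iff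
    (intervalIntegral.integral_nonneg ha1 fun r _ => hm0 r)).1 hfin

lemma IsTransition.continuousOn (hS : S.Standing) {t : ℝ} {u₀ u₁ : V} {ϑ : ℝ → V}
    (h : S.IsTransition t u₀ u₁ ϑ) : ContinuousOn ϑ (Icc 0 1) := by
  obtain ⟨e, he, hϑe⟩ := h.exists_sublevel
  exact continuousOn_of_gaugeAC hS.psi_continuous hS.psi_pos (hS.E_coercive e he) h.gaugeAC hϑe

/-- By semicontinuity of the instability every unstable interior time lies inside a rational
interval of unstable times. The Radon–Nikodým property applies on each of these countably many
intervals. -/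
lemma IsTransition.differentiableAt [TopologicalSpace.SeparableSpace V]
    (hV : RadonNikodymProperty V) (hS : S.Standing) {t : ℝ} (ht : t ∈ Icc (0 : ℝ) S.T) {u₀ u₁ : V}
    {ϑ : ℝ → V} (h : S.IsTransition t u₀ u₁ ϑ) :
    ∀ᵐ r, r ∈ Ioo (0 : ℝ) 1 → r ∈ S.unstableTimes t ϑ → DifferentiableAt ℝ ϑ r := by
  obtain ⟨e, he, hϑe⟩ := h.exists_sublevel
  have h1 : ∀ᵐ r, ∀ p : ℚ × ℚ, Icc (p.1 : ℝ) p.2 ⊆ S.unstableTimes t ϑ →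
      r ∈ Ioo (p.1 : ℝ) p.2 → DifferentiableAt ℝ ϑ r := by
    refine ae_all_iff.2 fun p => ?_
    by_cases hp : Icc (p.1 : ℝ) p.2 ⊆ S.unstableTimes t ϑ ∧ (p.1 : ℝ) ≤ p.2
    · filter_upwards [(ae_restrict_iff' measurableSet_Ioo).1
        (hV ϑ p.1 p.2 (h.normACLoc _ _ hp.2 hp.1))] with r hr _ using hr
    · refine Eventually.of_forall fun r hr hrp => absurd ⟨hr, ?_⟩ hp
      exact hrp.1.le.trans hrp.2.le
  filter_upwards [h1] with r hr hr01 hrG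
  have h2 := eventually_lt_instability_comp hS he ht (h.continuousOn hS) hϑe hrG.1 le_rfl
    (by rw [ENNReal.ofReal_zero]; exact hrG.2)
  rw [nhdsWithin_eq_nhds.2 (Icc_mem_nhds hr01.1 hr01.2)] at h2
  obtain ⟨l, b, hlb, hsub⟩ := mem_nhds_iff_exists_Ioo_subset.1
    (h2.and (Icc_mem_nhds hr01.1 hr01.2))
  obtain ⟨q₁, hq₁⟩ := exists_rat_btwn hlb.1
  obtain ⟨q₂, hq₂⟩ := exists_rat_btwn hlb.2
  refine hr (q₁, q₂) (fun s hs => ?_) ⟨hq₁.2, hq₂.1⟩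
  have := hsub (⟨hq₁.1.trans_le hs.1, hs.2.trans_lt hq₂.2⟩ : s ∈ Ioo l b)
  exact ⟨this.2, by simpa using this.1⟩

/-- A transition of finite cost has a majorant carrying its cost. -/
lemma IsTransition.exists_majorant [TopologicalSpace.SeparableSpace V]
    (hV : RadonNikodymProperty V) (hS : S.Standing) {t : ℝ} (ht : t ∈ Icc (0 : ℝ) S.T) {u₀ u₁ : V}
    {ϑ : ℝ → V} (h : S.IsTransition t u₀ u₁ ϑ) (hfin : S.curveCost t ϑ ≠ ⊤) :
    ∃ m : ℝ → ℝ, (∀ r, 0 ≤ m r) ∧ Integrable m ∧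
      (∀ r, ENNReal.ofReal (m r) ≤ S.costDensity t ϑ r) ∧ S.IsMajorant t ϑ m ∧
      S.curveCost t ϑ = ENNReal.ofReal (∫ r in (0 : ℝ)..1, m r) := by
  obtain ⟨m, hm0, hmi, hmle, hmeq⟩ := exists_integrable_minorant hfin
  refine ⟨m, hm0, hmi, hmle, fun p q c hp hpq hq hc hlow => ?_,
    hmeq 0 1 le_rfl zero_le_one le_rfl⟩
  have hdiff := h.differentiableAt hV hS ht
  have hsub : Ioo p q ⊆ Ioo 0 1 := Ioo_subset_Ioo hp hq
  rw [← ENNReal.ofReal_le_ofReal_iff (intervalIntegral.integral_nonneg hpq fun r _ => hm0 r),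
    ← hmeq p q hp hpq hq]
  -- For weight `0` the interval may meet stable times, and only `Ψ`-absolute continuity is
  -- available. A positive weight forces the interval into the unstable set, where the curve is
  -- absolutely continuous in norm.
  rcases hc.eq_or_lt with rfl | hc
  · rw [zero_mul, add_zero]
    refine (hS.isGauge.ofReal_sub_le_lintegral_metricDeriv hpq
      (h.gaugeAC.mono hp hq zero_le_one fun v => by rw [one_mul])).trans (lintegral_mono_ae ?_)
    filter_upwards [ae_restrict_of_ae (s := Ioo p q) hdiff, ae_restrict_mem measurableSet_Ioo]
      with r hr hrI
    rw [costDensity]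
    split_ifs with hG
    · rw [metricDeriv_of_differentiableAt hS.psi_continuous (hr (hsub hrI) hG)]
      simpa using le_finsler hS (c := 0) (u := ϑ r) (t := t) (by simp) (deriv ϑ r)
    · exact le_rfl
  · have hG : Icc p q ⊆ S.unstableTimes t ϑ := fun r hr =>
      ⟨⟨hp.trans hr.1, hr.2.trans hq⟩, (ENNReal.ofReal_pos.2 hc).trans_le (hlow r hr)⟩
    obtain ⟨L, hL, hΨL⟩ := hS.isGauge.exists_le_mul_norm hS.psi_continuous
    have hN := hS.isGauge.add_norm hc.le
    have hcN : Continuous fun v : V => S.Ψ v + c * ‖v‖ :=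
      hS.psi_continuous.add (continuous_const.mul continuous_norm)
    have hac : GaugeAC (fun v : V => S.Ψ v + c * ‖v‖) ϑ p q :=
      GaugeAC.mono (L := L + c) (h.normACLoc p q hpq hG) le_rfl le_rfl (by linarith)
        fun v => by rw [add_mul]; linarith [hΨL v]
    refine (hN.ofReal_sub_le_lintegral_metricDeriv hpq hac).trans (lintegral_mono_ae ?_)
    filter_upwards [ae_restrict_of_ae (s := Ioo p q) hdiff, ae_restrict_mem measurableSet_Ioo]
      with r hr hrI
    have hrG := hG (Ioo_subset_Icc_self hrI)
    rw [costDensity, if_pos hrG, metricDeriv_of_differentiableAt hcN (hr (hsub hrI) hrG)]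
    exact le_finsler hS (hlow r (Ioo_subset_Icc_self hrI)) _

end RISystem

/-! ### Arc-length reparametrization and Ascoli's theorem. -/

/-- Arc-length type reparametrization of an interval with respect to the density `κ + m`. -/
lemma exists_reparametrization {m : ℝ → ℝ} (hm0 : ∀ r, 0 ≤ m r) (hmi : Integrable m) {α β κ : ℝ}
    (hαβ : α ≤ β) (hκ : 0 < κ) :
    ∃ τ : ℝ → ℝ, NormAC τ 0 1 ∧ τ '' Icc 0 1 = Icc α β ∧ MonotoneOn τ (Icc 0 1) ∧
      (α < β → StrictMonoOn τ (Icc 0 1)) ∧ τ 0 = α ∧ τ 1 = β ∧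
      ∀ p ∈ Icc (0 : ℝ) 1, ∀ q ∈ Icc (0 : ℝ) 1, p ≤ q →
        ∫ r in τ p..τ q, m r ≤ (κ * (β - α) + ∫ r in α..β, m r) * (q - p) := by
  -- Adding `κ` to the density makes arc length strictly increasing with a Lipschitz inverse even
  -- where `m` vanishes.
  set s : ℝ → ℝ := fun r => κ * (r - α) + ∫ x in α..r, m x with hs
  set C := κ * (β - α) + ∫ r in α..β, m r with hC
  have hsc : Continuous s := by
    have h1 : Continuous fun r => ∫ x in α..r, m x :=
      intervalIntegral.continuous_primitive (fun _ _ => hmi.intervalIntegrable) α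
    fun_prop
  have hsub : ∀ p q, s q - s p = κ * (q - p) + ∫ x in p..q, m x := fun p q => by
    have := intervalIntegral.integral_interval_sub_left (a := α) (b := q) (c := p)
      hmi.intervalIntegrable (hmi.intervalIntegrable (μ := volume))
    simp only [hs]
    linarith
  have hm0' : ∀ p q, p ≤ q → 0 ≤ ∫ r in p..q, m r := fun p q hpq =>
    intervalIntegral.integral_nonneg hpq fun r _ => hm0 r
  have hsm : StrictMono s := fun p q hpq => by
    have h1 := hsub p q
    have h2 := mul_pos hκ (sub_pos.2 hpq)
    have h3 := hm0' p q hpq.le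
    linarith
  have hsα : s α = 0 := by simp [hs]
  have hsβ : s β = C := rfl
  have hC0 : 0 ≤ C := by
    rw [← hsα, ← hsβ]
    exact hsm.monotone hαβ
  have hex : ∀ x ∈ Icc (0 : ℝ) 1, ∃ r ∈ Icc α β, s r = C * x := fun x hx =>
    intermediate_value_Icc hαβ hsc.continuousOn
      (⟨by rw [hsα]; exact mul_nonneg hC0 hx.1, by rw [hsβ]; nlinarith [hx.2]⟩ : C * x ∈ Icc _ _)
  choose! τ hτ hsτ using hex
  have hkey : ∀ p ∈ Icc (0 : ℝ) 1, ∀ q ∈ Icc (0 : ℝ) 1,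
      κ * (τ q - τ p) + ∫ r in τ p..τ q, m r = C * (q - p) := fun p hp q hq => by
    rw [← hsub, hsτ p hp, hsτ q hq]; ring
  have hmono : MonotoneOn τ (Icc 0 1) := fun p hp q hq hpq => by
    rw [← hsm.le_iff_le, hsτ p hp, hsτ q hq]
    exact mul_le_mul_of_nonneg_left hpq hC0
  have h0 : (0 : ℝ) ∈ Icc (0 : ℝ) 1 := by simp
  have h1 : (1 : ℝ) ∈ Icc (0 : ℝ) 1 := by simp
  refine ⟨τ, ⟨fun _ => C / κ, fun _ => by positivity, by simp, fun p q hp hpq hq => ?_⟩, ?_, hmono,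
    fun hlt p hp q hq hpq => ?_, ?_, ?_, fun p hp q hq hpq => ?_⟩
  · have hp' : p ∈ Icc (0 : ℝ) 1 := ⟨hp, hpq.trans hq⟩
    have hq' : q ∈ Icc (0 : ℝ) 1 := ⟨hp.trans hpq, hq⟩
    have h2 := hmono hp' hq' hpq
    simp only [intervalIntegral.integral_const, smul_eq_mul]
    rw [Real.norm_of_nonneg (sub_nonneg.2 h2), mul_div_assoc', le_div_iff₀ hκ]
    linarith [hkey p hp' q hq', hm0' _ _ h2]
  · refine Subset.antisymm (image_subset_iff.2 fun x hx => hτ x hx) fun r hr => ?_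
    rcases hαβ.eq_or_lt with h | h
    · subst h
      have hr' : r = α := le_antisymm hr.2 hr.1
      exact ⟨0, h0, by rw [hr']; exact le_antisymm (hτ 0 h0).2 (hτ 0 h0).1⟩
    · have hCpos : 0 < C := by
        rw [← hsα, ← hsβ]
        exact hsm h
      have hx : s r / C ∈ Icc (0 : ℝ) 1 := by
        constructor
        · refine div_nonneg ?_ hC0
          rw [← hsα]
          exact hsm.monotone hr.1
        · rw [div_le_one hCpos, ← hsβ]
          exact hsm.monotone hr.2
      refine ⟨s r / C, hx, hsm.injective ?_⟩
      rw [hsτ _ hx, mul_div_cancel₀ _ hCpos.ne']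
  · have hCpos : 0 < C := by
      rw [← hsα, ← hsβ]
      exact hsm hlt
    rw [← hsm.lt_iff_lt, hsτ p hp, hsτ q hq]
    exact mul_lt_mul_of_pos_left hpq hCpos
  · refine hsm.injective ?_
    rw [hsτ 0 h0, hsα, mul_zero]
  · refine hsm.injective ?_
    rw [hsτ 1 h1, hsβ, mul_one]
  · have h2 := mul_nonneg hκ.le (sub_nonneg.2 (hmono hp hq hpq))
    linarith [hkey p hp q hq]

/-- Ascoli's theorem for asymptotically equicontinuous sequences of maps on `[0,1]`, not
necessarily continuous, with values in a compact set. -/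
lemma exists_subseq_tendstoUniformlyOn {X : Type*} [MetricSpace X] [CompleteSpace X] {K : Set X}
    (hK : IsCompact K) {w : ℕ → ℝ → X} (hw : ∀ n, ∀ r ∈ Icc (0 : ℝ) 1, w n r ∈ K)
    (heq : ∀ δ > 0, ∃ ρ > 0, ∀ᶠ n in atTop, ∀ p ∈ Icc (0 : ℝ) 1, ∀ q ∈ Icc (0 : ℝ) 1,
      |p - q| < ρ → dist (w n p) (w n q) < δ) :
    ∃ (φ : ℕ → ℕ) (ϑ : ℝ → X), StrictMono φ ∧
      TendstoUniformlyOn (fun n => w (φ n)) ϑ atTop (Icc 0 1) := by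
  -- Diagonal extraction at rational times; `projIcc` only gives a value at rationals outside
  -- `[0,1]`.
  obtain ⟨a, -, φ, hφ, hlim⟩ := (isCompact_univ_pi fun _ : ℚ => hK).tendsto_subseq
    (x := fun n (q : ℚ) => w n (projIcc (0 : ℝ) 1 zero_le_one (q : ℝ)))
    (fun n q _ => hw n _ (projIcc _ _ _ _).2)
  have hrat : ∀ q : ℚ, (q : ℝ) ∈ Icc (0 : ℝ) 1 → CauchySeq fun n => w (φ n) q := fun q hq => by
    have h1 := (tendsto_pi_nhds.1 hlim q).cauchySeq
    simp only [Function.comp_def, projIcc_of_mem zero_le_one hq] at h1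
    exact h1
  have hcauchy : UniformCauchySeqOn (fun n => w (φ n)) atTop (Icc 0 1) := by
    rw [Metric.uniformCauchySeqOn_iff]
    intro δ hδ
    obtain ⟨ρ, hρ, hN⟩ := heq (δ / 3) (by linarith)
    obtain ⟨M, hM⟩ := exists_nat_one_div_lt hρ
    have hgrid : ∀ᶠ N in atTop, ∀ i ∈ Finset.range (M + 2), ∀ m ≥ N, ∀ n ≥ N,
        dist (w (φ m) (min 1 (i / (M + 1) : ℝ))) (w (φ n) (min 1 (i / (M + 1) : ℝ))) < δ / 3 := by
      refine (Filter.eventually_all_finset _).2 fun i _ => ?_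
      have h1 := hrat (min 1 (i / (M + 1) : ℚ)) (by
        push_cast
        exact ⟨le_min zero_le_one (by positivity), min_le_left _ _⟩)
      push_cast at h1
      obtain ⟨N, hN⟩ := Metric.cauchySeq_iff.1 h1 (δ / 3) (by linarith)
      filter_upwards [eventually_ge_atTop N] with N' hN' m hm n hn
        using hN m (hN'.trans hm) n (hN'.trans hn)
    obtain ⟨N₁, hN₁⟩ := eventually_atTop.1 (hφ.tendsto_atTop.eventually hN)
    obtain ⟨N₂, hN₂, hN₂'⟩ := (hgrid.and (eventually_ge_atTop N₁)).exists
    refine ⟨N₂, fun m hm n hn r hr => ?_⟩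
    have hM1 : (0 : ℝ) < M + 1 := by positivity
    set i := ⌊r * (M + 1)⌋₊ with hi
    have hi1 : (i : ℝ) ≤ r * (M + 1) := Nat.floor_le (mul_nonneg hr.1 hM1.le)
    have hi2 : r * (M + 1) < i + 1 := Nat.lt_floor_add_one _
    have hg1 : (i / (M + 1) : ℝ) ≤ r := by rwa [div_le_iff₀ hM1]
    have hg2 : r - (i / (M + 1) : ℝ) < ρ := by
      refine lt_of_le_of_lt ?_ hM
      rw [sub_le_iff_le_add, ← add_div, le_div_iff₀ hM1]
      linarith
    have hir : i ∈ Finset.range (M + 2) := by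
      rw [Finset.mem_range]
      have : (i : ℝ) < M + 2 := by nlinarith [hr.2]
      exact_mod_cast this
    have hgm := hN₂ i hir m hm n hn
    rw [min_eq_right (hg1.trans hr.2)] at hgm
    have hgI : (i / (M + 1) : ℝ) ∈ Icc (0 : ℝ) 1 := ⟨by positivity, hg1.trans hr.2⟩
    have habs : |r - (i / (M + 1) : ℝ)| < ρ := by rwa [abs_of_nonneg (sub_nonneg.2 hg1)]
    have hd1 := hN₁ m (hN₂'.trans hm) r hr _ hgI habs
    have hd2 := hN₁ n (hN₂'.trans hn) r hr _ hgI habs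
    rw [dist_comm] at hd2
    linarith [dist_triangle4 (w (φ m) r) (w (φ m) (i / (M + 1) : ℝ)) (w (φ n) (i / (M + 1) : ℝ))
      (w (φ n) r)]
  have hpt : ∀ r, ∃ x, r ∈ Icc (0 : ℝ) 1 → Tendsto (fun n => w (φ n) r) atTop (𝓝 x) := fun r => by
    by_cases hr : r ∈ Icc (0 : ℝ) 1
    · obtain ⟨x, hx⟩ := cauchySeq_tendsto_of_complete (hcauchy.cauchySeq hr)
      exact ⟨x, fun _ => hx⟩
    · exact ⟨w 0 0, fun h => absurd h hr⟩
  choose ϑ hϑ using hpt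
  exact ⟨φ, ϑ, hφ, hcauchy.tendstoUniformlyOn_of_tendsto fun r hr => hϑ r hr⟩

/-! ### Compactness: limits of almost majorized curves. -/

namespace RISystem

variable {V : Type*} [NormedAddCommGroup V] [NormedSpace ℝ V] {S : RISystem V}

/-- Passage to the limit yields bounds only for weights strictly below the instability; letting the
weight increase recovers the density. For `v ≠ 0` such bounds also force the instability to be
finite. -/
lemma finsler_le_of_forall (hS : S.Standing) {t : ℝ} {u v : V} {M : ℝ} (hM : 0 ≤ M)
    (h0 : 0 < S.instability t u)
    (h : ∀ c : ℝ, 0 ≤ c → ENNReal.ofReal c < S.instability t u → S.Ψ v + c * ‖v‖ ≤ M) :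
    S.finsler t u v ≤ ENNReal.ofReal M := by
  by_cases hv : v = 0
  · rw [finsler, if_pos hv]
    exact bot_le
  have hv' : 0 < ‖v‖ := norm_pos_iff.2 hv
  have htop : S.instability t u ≠ ⊤ := fun htop => by
    have h1 := h ((M + 1) / ‖v‖) (by positivity) (by rw [htop]; exact ENNReal.ofReal_lt_top)
    rw [div_mul_cancel₀ _ hv'.ne'] at h1
    linarith [hS.psi_nonneg v]
  set i := (S.instability t u).toReal with hi
  have hi0 : 0 < i := ENNReal.toReal_pos h0.ne' htop
  have hii : S.instability t u = ENNReal.ofReal i := (ENNReal.ofReal_toReal htop).symm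
  have hle : S.Ψ v + i * ‖v‖ ≤ M := by
    refine le_of_forall_pos_le_add fun δ hδ => ?_
    have h1 := h (max 0 (i - δ / ‖v‖)) (le_max_left _ _) (by
      rw [hii, ENNReal.ofReal_lt_ofReal_iff hi0]
      exact max_lt hi0 (sub_lt_self _ (by positivity)))
    have h2 := mul_le_mul_of_nonneg_right (le_max_right 0 (i - δ / ‖v‖)) hv'.le
    rw [sub_mul, div_mul_cancel₀ _ hv'.ne'] at h2
    linarith
  refine ENNReal.le_of_forall_pos_le_add fun δ hδ _ => ?_
  have hδ' : (0 : ℝ) < δ := hδ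
  have h1 := finsler_le hS (t := t) (u := u) (c := i + δ / ‖v‖)
    (by rw [hii, ENNReal.ofReal_lt_ofReal_iff (by positivity)]
        exact lt_add_of_pos_right _ (by positivity)) v
  refine h1.trans ?_
  rw [← ENNReal.ofReal_coe_nnreal, ← ENNReal.ofReal_add hM hδ'.le]
  refine ENNReal.ofReal_le_ofReal ?_
  rw [add_mul, div_mul_cancel₀ _ hv'.ne']
  linarith

/-- A quantitative form of the compactness of curves of bounded dissipation: almost majorized curves
with time-dependent instabilities converge, up to a subsequence, to a transition whose cost is
bounded by the limit of the dissipation. -/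
lemma exists_limit_transition [CompleteSpace V] [TopologicalSpace.SeparableSpace V]
    (hS : S.Standing) {e : ℝ}
    (he : 0 < e) {t : ℝ} (ht : t ∈ Icc (0 : ℝ) S.T) {u₀ u₁ : V} {η w : ℕ → ℝ → V}
    {ts : ℕ → ℝ → ℝ} {C : ℕ → ℝ} {Cl : ℝ} (hts : ∀ n, ∀ r ∈ Icc (0 : ℝ) 1, ts n r ∈ Icc (0 : ℝ) S.T)
    (hw : ∀ n, ∀ r ∈ Icc (0 : ℝ) 1, w n r ∈ S.sublevel e)
    (hclose : ∀ δ > 0, ∀ᶠ n in atTop, ∀ r ∈ Icc (0 : ℝ) 1, ‖w n r - η n r‖ ≤ δ)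
    (htlim : TendstoUniformlyOn ts (fun _ => t) atTop (Icc 0 1))
    (hC0 : ∀ n, 0 ≤ C n) (hC : Tendsto C atTop (𝓝 Cl))
    (hmaj : ∀ n, ∀ p q c : ℝ, 0 ≤ p → p ≤ q → q ≤ 1 → 0 ≤ c →
      (∀ r ∈ Icc p q, ENNReal.ofReal c ≤ S.instability (ts n r) (w n r)) →
        S.Ψ (η n q - η n p) + c * ‖η n q - η n p‖ ≤ C n * (q - p))
    (h0 : Tendsto (fun n => η n 0) atTop (𝓝 u₀)) (h1 : Tendsto (fun n => η n 1) atTop (𝓝 u₁)) :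
    ∃ (φ : ℕ → ℕ) (ϑ : ℝ → V), StrictMono φ ∧ S.IsTransition t u₀ u₁ ϑ ∧
      TendstoUniformlyOn (fun n => η (φ n)) ϑ atTop (Icc 0 1) ∧
      S.curveCost t ϑ ≤ ENNReal.ofReal Cl := by
  have hK := hS.E_coercive e he
  have hCl : 0 ≤ Cl := ge_of_tendsto' hC hC0
  obtain ⟨L, hL, hΨL⟩ := hS.isGauge.exists_le_mul_norm hS.psi_continuous
  obtain ⟨B, hB⟩ := hC.bddAbove_range
  have hCB : ∀ n, C n ≤ B := fun n => hB ⟨n, rfl⟩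
  have hB0 : 0 ≤ B := (hC0 0).trans (hCB 0)
  -- extraction of a uniformly convergent subsequence
  obtain ⟨φ, ϑ, hφ, hunif⟩ := exists_subseq_tendstoUniformlyOn hK hw (fun δ hδ => by
    obtain ⟨μ, hμ, hmod⟩ := exists_modulus_of_isCompact hS.psi_continuous hS.psi_pos hK hδ
    refine ⟨μ / (3 * (B + 1)), by positivity, ?_⟩
    filter_upwards [hclose (μ / (3 * L)) (by positivity)] with n hn
    have key : ∀ p ∈ Icc (0 : ℝ) 1, ∀ q ∈ Icc (0 : ℝ) 1, p ≤ q → q - p < μ / (3 * (B + 1)) →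
        dist (w n p) (w n q) < δ := by
      intro p hp q hq hpq hlt
      rw [dist_comm, dist_eq_norm]
      refine hmod _ (hw n p hp) _ (hw n q hq) ?_
      have a1 := hmaj n p q 0 hp.1 hpq hq.2 le_rfl (by simp)
      rw [zero_mul, add_zero] at a1
      have a2 := hS.isGauge.sub_le (w n q) (η n q) (w n p)
      have a3 := hS.isGauge.sub_le (η n q) (η n p) (w n p)
      have hb : ∀ x : V, ‖x‖ ≤ μ / (3 * L) → S.Ψ x ≤ μ / 3 := fun x hx =>
        calc S.Ψ x ≤ L * ‖x‖ := hΨL x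
          _ ≤ L * (μ / (3 * L)) := mul_le_mul_of_nonneg_left hx hL.le
          _ = μ / 3 := by field_simp
      have a4 := hb _ (hn q hq)
      have a5 := hb (η n p - w n p) (by rw [norm_sub_rev]; exact hn p hp)
      rw [lt_div_iff₀ (by positivity)] at hlt
      have a6 : C n * (q - p) ≤ B * (q - p) :=
        mul_le_mul_of_nonneg_right (hCB n) (by linarith)
      nlinarith
    intro p hp q hq hpq
    rcases le_total p q with h | h
    · exact key p hp q hq h (by rwa [abs_sub_comm, abs_of_nonneg (by linarith)] at hpq)
    · rw [dist_comm]
      exact key q hq p hp h (by rwa [abs_of_nonneg (by linarith)] at hpq))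
  have hwpt : ∀ r ∈ Icc (0 : ℝ) 1, Tendsto (fun n => w (φ n) r) atTop (𝓝 (ϑ r)) :=
    fun r hr => hunif.tendsto_at hr
  have hηunif : TendstoUniformlyOn (fun n => η (φ n)) ϑ atTop (Icc 0 1) := by
    rw [Metric.tendstoUniformlyOn_iff] at hunif ⊢
    intro δ hδ
    filter_upwards [hunif (δ / 2) (by linarith),
      hφ.tendsto_atTop.eventually (hclose (δ / 3) (by linarith))] with n a1 a2 r hr
    have a3 := a1 r hr
    have a4 := a2 r hr
    rw [← dist_eq_norm] at a4
    linarith [dist_triangle (ϑ r) (w (φ n) r) (η (φ n) r)]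
  have hηpt : ∀ r ∈ Icc (0 : ℝ) 1, Tendsto (fun n => η (φ n) r) atTop (𝓝 (ϑ r)) :=
    fun r hr => hηunif.tendsto_at hr
  have hϑe : ∀ r ∈ Icc (0 : ℝ) 1, ϑ r ∈ S.sublevel e := fun r hr =>
    hK.isClosed.mem_of_tendsto (hwpt r hr) (Eventually.of_forall fun n => hw _ r hr)
  -- passage to the limit in the increments
  have hpass : ∀ p q c : ℝ, 0 ≤ p → p ≤ q → q ≤ 1 → 0 ≤ c →
      (∀ᶠ n in atTop, ∀ r ∈ Icc p q,
        ENNReal.ofReal c < S.instability (ts (φ n) r) (w (φ n) r)) →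
      S.Ψ (ϑ q - ϑ p) + c * ‖ϑ q - ϑ p‖ ≤ Cl * (q - p) := by
    intro p q c hp hpq hq hc hev
    have hd := (hηpt q ⟨hp.trans hpq, hq⟩).sub (hηpt p ⟨hp, hpq.trans hq⟩)
    refine le_of_tendsto_of_tendsto (((hS.psi_continuous.tendsto _).comp hd).add
      (hd.norm.const_mul c)) ((hC.comp hφ.tendsto_atTop).mul_const (q - p)) ?_
    filter_upwards [hev] with n hn
    exact hmaj (φ n) p q c hp hpq hq hc fun r hr => (hn r hr).le
  have hpass0 : ∀ p q : ℝ, 0 ≤ p → p ≤ q → q ≤ 1 → S.Ψ (ϑ q - ϑ p) ≤ Cl * (q - p) := by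
    intro p q hp hpq hq
    have hd := (hηpt q ⟨hp.trans hpq, hq⟩).sub (hηpt p ⟨hp, hpq.trans hq⟩)
    refine le_of_tendsto_of_tendsto' ((hS.psi_continuous.tendsto _).comp hd)
      ((hC.comp hφ.tendsto_atTop).mul_const (q - p)) fun n => ?_
    simpa using hmaj (φ n) p q 0 hp hpq hq le_rfl (by simp)
  have hAC : GaugeAC S.Ψ ϑ 0 1 :=
    ⟨fun _ => Cl, fun _ => hCl, by simp, fun p q hp hpq hq => by
      simpa [mul_comm] using hpass0 p q hp hpq hq⟩
  have hϑc : ContinuousOn ϑ (Icc 0 1) :=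
    continuousOn_of_gaugeAC hS.psi_continuous hS.psi_pos hK hAC hϑe
  -- lower semicontinuity of the instability along the sequence
  have hlsc : ∀ r ∈ Icc (0 : ℝ) 1, ∀ c : ℝ, 0 ≤ c → ENNReal.ofReal c < S.instability t (ϑ r) →
      ∃ U ∈ 𝓝 r, ∀ᶠ n in atTop, ∀ s ∈ U, s ∈ Icc (0 : ℝ) 1 →
        ENNReal.ofReal c < S.instability (ts (φ n) s) (w (φ n) s) := by
    intro r hr c hc hlt
    have a1 := eventually_lt_instability hS he (t := t) (u := ϑ r) hc hlt
    obtain ⟨δ, hδ, hball⟩ := Metric.mem_nhdsWithin_iff.1 a1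
    obtain ⟨ρ, hρ, hρb⟩ := Metric.continuousWithinAt_iff.1 (hϑc r hr) (δ / 2) (by linarith)
    refine ⟨Metric.ball r ρ, Metric.ball_mem_nhds r hρ, ?_⟩
    filter_upwards [Metric.tendstoUniformlyOn_iff.1 hunif (δ / 2) (by linarith),
      hφ.tendsto_atTop.eventually (Metric.tendstoUniformlyOn_iff.1 htlim δ hδ)] with n a2 a3 s hs hsI
    suffices h : (ts (φ n) s, w (φ n) s) ∈ Metric.ball (t, ϑ r) δ from
      hball (⟨h, hts _ s hsI, hw _ s hsI⟩ : _ ∈ _ ∩ _ ×ˢ _)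
    rw [Metric.mem_ball, Prod.dist_eq, max_lt_iff]
    constructor
    · rw [dist_comm]; exact a3 s hsI
    · have a4 := a2 s hsI
      have a5 := hρb hsI hs
      rw [dist_comm] at a4
      linarith [dist_triangle (w (φ n) s) (ϑ s) (ϑ r)]
  refine ⟨φ, ϑ, hφ, ⟨⟨e, he, hϑe⟩, hAC, fun a b hab hG => ?_,
    tendsto_nhds_unique (hηpt 0 (by simp)) (h0.comp hφ.tendsto_atTop),
    tendsto_nhds_unique (hηpt 1 (by simp)) (h1.comp hφ.tendsto_atTop)⟩, hηunif, ?_⟩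
  · -- local Lipschitz continuity on unstable intervals
    have hlscI : LowerSemicontinuousOn (fun r => S.instability t (ϑ r)) (Icc a b) := by
      intro r hr y hy
      obtain ⟨c, hc1, hc2⟩ := ENNReal.lt_iff_exists_nnreal_btwn.1 hy
      rw [← ENNReal.ofReal_coe_nnreal] at hc1 hc2
      have a1 := eventually_lt_instability_comp hS he ht hϑc hϑe (hG hr).1 c.2 hc2
      filter_upwards [nhdsWithin_mono r (fun x hx => (hG hx).1) a1] with s hs using hc1.trans hs
    obtain ⟨r₀, hr₀, hmin⟩ := hlscI.exists_isMinOn (nonempty_Icc.2 hab) isCompact_Icc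
    obtain ⟨c, hc1, hc2⟩ := ENNReal.lt_iff_exists_nnreal_btwn.1 (hG hr₀).2
    have hc0 : (0 : ℝ) < c := by exact_mod_cast hc1
    rw [← ENNReal.ofReal_coe_nnreal] at hc2
    have hev : ∀ᶠ n in atTop, ∀ s ∈ Icc a b,
        ENNReal.ofReal c < S.instability (ts (φ n) s) (w (φ n) s) := by
      -- `hlsc` gives the bound near each point from some index on; compactness makes the index
      -- common to `[a,b]`. The inequality with weight `c` then gives the Lipschitz constant `Cl /
      -- c`.
      refine isCompact_Icc.induction_on (p := fun A => ∀ᶠ n in atTop, ∀ s ∈ A,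
        ENNReal.ofReal c < S.instability (ts (φ n) s) (w (φ n) s)) (by simp)
        (fun A A' hAA h => h.mono fun n hn s hs => hn s (hAA hs))
        (fun A A' h h' => by
          filter_upwards [h, h'] with n hn hn' s hs using hs.elim (hn s) (hn' s)) fun r hr => ?_
      obtain ⟨U, hU, hUn⟩ := hlsc r (hG hr).1 c hc0.le (hc2.trans_le (hmin hr))
      exact ⟨U ∩ Icc a b, inter_mem (mem_nhdsWithin_of_mem_nhds hU) self_mem_nhdsWithin,
        hUn.mono fun n hn s hs => hn s hs.1 (hG hs.2).1⟩
    refine ⟨fun _ => Cl / c, fun _ => by positivity, by simp, fun p q hp hpq hq => ?_⟩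
    have a1 := hpass p q c (hG ⟨hp, hpq.trans hq⟩).1.1 hpq (hG ⟨hp.trans hpq, hq⟩).1.2 hc0.le
      (hev.mono fun n hn r hr => hn r ⟨hp.trans hr.1, hr.2.trans hq⟩)
    simp only [intervalIntegral.integral_const, smul_eq_mul]
    rw [mul_div_assoc', le_div_iff₀ hc0]
    linarith [hS.psi_nonneg (ϑ q - ϑ p)]
  · -- pointwise bound of the cost density
    have hdens : ∀ r ∈ Ioo (0 : ℝ) 1, S.costDensity t ϑ r ≤ ENNReal.ofReal Cl := by
      intro r hr
      have hrI := Ioo_subset_Icc_self hr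
      rw [costDensity]
      split_ifs with hG
      · refine finsler_le_of_forall hS hCl hG.2 fun c hc hlt => ?_
        by_cases hd : DifferentiableAt ℝ ϑ r
        · obtain ⟨U, hU, hUn⟩ := hlsc r hrI c hc hlt
          have a1 := ((hasDerivAt_iff_tendsto_slope_zero.1 hd.hasDerivAt).mono_left
            (nhdsWithin_mono (0 : ℝ) fun x (hx : x ∈ Ioi (0 : ℝ)) => ne_of_gt hx))
          refine le_of_tendsto (((hS.psi_continuous.tendsto _).comp a1).add
            (a1.norm.const_mul c)) ?_
          filter_upwards [eventually_forall_Icc hU,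
            eventually_forall_Icc (Icc_mem_nhds hr.1 hr.2), self_mem_nhdsWithin] with h a2 a3
            (hpos : 0 < h)
          have a4 := hpass r (r + h) c hr.1.le (by linarith)
            (a3 _ (right_mem_Icc.2 (by linarith))).2 hc
            (hUn.mono fun n hn s hs => hn s (a2 s hs) (a3 s hs))
          rw [Function.comp_apply, hS.psi_homogeneous _ _ (inv_nonneg.2 hpos.le), norm_smul,
            norm_inv, Real.norm_of_nonneg hpos.le, mul_left_comm, ← mul_add, inv_mul_eq_div,
            div_le_iff₀ hpos]
          linarith
        -- The default value `0` of `deriv` makes the bound trivial at points of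
        -- nondifferentiability.
        · rw [deriv_zero_of_not_differentiableAt hd, norm_zero, hS.isGauge.map_zero]
          simpa using hCl
      · refine metricDeriv_le ?_
        have a1 : ∀ᶠ h in 𝓝 (0 : ℝ), r + h ∈ Icc (0 : ℝ) 1 := by
          have a2 := (continuous_const_add r).tendsto (0 : ℝ)
          rw [add_zero] at a2
          exact a2 (Icc_mem_nhds hr.1 hr.2)
        filter_upwards [mem_nhdsWithin_of_mem_nhds a1, self_mem_nhdsWithin] with h a2
          (hne : h ≠ 0)
        -- `Ψ` need not be symmetric, so a backward quotient is first rewritten as a forward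
        -- increment.
        rcases lt_or_gt_of_ne hne with hneg | hpos
        · have a3 : h⁻¹ • (ϑ (r + h) - ϑ r) = (-h)⁻¹ • (ϑ r - ϑ (r + h)) := by
            rw [inv_neg, neg_smul, ← smul_neg, neg_sub]
          have a4 := hpass0 (r + h) r a2.1 (by linarith) hr.2.le
          have hpos : 0 < -h := by linarith
          rw [a3, hS.psi_homogeneous _ _ (inv_nonneg.2 hpos.le), inv_mul_eq_div,
            div_le_iff₀ hpos]
          linarith
        · have a4 := hpass0 r (r + h) hr.1.le (by linarith) a2.2
          rw [hS.psi_homogeneous _ _ (inv_nonneg.2 hpos.le), inv_mul_eq_div, div_le_iff₀ hpos]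
          linarith
    calc S.curveCost t ϑ ≤ ∫⁻ _ in Ioo (0 : ℝ) 1, ENNReal.ofReal Cl :=
          setLIntegral_mono' measurableSet_Ioo hdens
      _ = ENNReal.ofReal Cl := by simp

end RISystem

/-! ### Monotone time changes and time reversal. -/

/-- Bounds on the instability are assumed in the new time but needed in the old one. Each old time
in question has a preimage inside `[p,q]`, even where `τ` is constant. -/
lemma Icc_subset_image_of_monotoneOn {τ : ℝ → ℝ} {α β : ℝ} (hmono : MonotoneOn τ (Icc 0 1))
    (himg : τ '' Icc 0 1 = Icc α β) {p q : ℝ} (hp : p ∈ Icc (0 : ℝ) 1) (hq : q ∈ Icc (0 : ℝ) 1)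
    (hpq : p ≤ q) : Icc (τ p) (τ q) ⊆ τ '' Icc p q := by
  intro s hs
  have hsI : s ∈ τ '' Icc 0 1 := by
    have h1 := himg ▸ mem_image_of_mem τ hp
    have h2 := himg ▸ mem_image_of_mem τ hq
    rw [himg]
    exact ⟨h1.1.trans hs.1, hs.2.trans h2.2⟩
  obtain ⟨r, hr, rfl⟩ := hsI
  rcases lt_or_ge r p with h | h
  · exact ⟨p, left_mem_Icc.2 hpq, le_antisymm hs.1 (hmono hr hp h.le)⟩
  rcases lt_or_ge q r with h' | h'
  · exact ⟨q, right_mem_Icc.2 hpq, le_antisymm (hmono hq hr h'.le) hs.2⟩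
  · exact ⟨r, ⟨h, h'⟩, rfl⟩

lemma GaugeAC.reverse {V : Type*} [AddCommGroup V] {N : V → ℝ} (hN : ∀ v, N (-v) = N v)
    {u : ℝ → V} {a b : ℝ} (hab : a ≤ b) (h : GaugeAC N u (1 - b) (1 - a)) :
    GaugeAC N (fun r => u (1 - r)) a b := by
  obtain ⟨m, hm0, hmi, hm⟩ := h
  refine ⟨fun r => m (1 - r), fun r => hm0 _, ?_, fun s t hs hst ht => ?_⟩
  · rw [← intervalIntegrable_iff_integrableOn_Icc_of_le (by linarith)] at hmi
    have h1 := (hmi.comp_sub_left 1).symm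
    simp only [sub_sub_cancel] at h1
    exact (intervalIntegrable_iff_integrableOn_Icc_of_le hab).1 h1
  · rw [intervalIntegral.integral_comp_sub_left, ← hN, neg_sub]
    exact hm _ _ (by linarith) (by linarith) (by linarith)

lemma metricDeriv_reverse {V : Type*} [AddCommGroup V] [Module ℝ V] {N : V → ℝ}
    (hN : ∀ v, N (-v) = N v) (u : ℝ → V) (r : ℝ) :
    metricDeriv N (fun r => u (1 - r)) r = metricDeriv N u (1 - r) := by
  have hmap : map (fun h : ℝ => -h) (𝓝[≠] (0 : ℝ)) = 𝓝[≠] (0 : ℝ) := by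
    simp
  unfold metricDeriv
  conv_rhs => rw [← hmap]
  rw [← limsup_comp]
  congr 1
  ext h
  simp only [Function.comp_apply]
  rw [← hN, ← smul_neg, inv_neg, neg_smul, smul_neg]
  ring_nf

namespace RISystem

variable {V : Type*} [NormedAddCommGroup V] [NormedSpace ℝ V] {S : RISystem V}

lemma mem_unstableTimes_reverse {t : ℝ} {ϑ : ℝ → V} {r : ℝ} :
    r ∈ S.unstableTimes t (fun r => ϑ (1 - r)) ↔ 1 - r ∈ S.unstableTimes t ϑ := by
  simp only [unstableTimes, mem_ofPred_eq, mem_Icc]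
  constructor <;> rintro ⟨⟨h1, h2⟩, h3⟩ <;> exact ⟨⟨by linarith, by linarith⟩, h3⟩

lemma IsTransition.reverse (hsymm : ∀ v, S.Ψ (-v) = S.Ψ v) {t : ℝ} {u₀ u₁ : V} {ϑ : ℝ → V}
    (h : S.IsTransition t u₀ u₁ ϑ) : S.IsTransition t u₁ u₀ (fun r => ϑ (1 - r)) where
  exists_sublevel := by
    obtain ⟨e, he, hϑ⟩ := h.exists_sublevel
    exact ⟨e, he, fun r hr => hϑ _ ⟨by linarith [hr.2], by linarith [hr.1]⟩⟩
  gaugeAC := GaugeAC.reverse hsymm zero_le_one (by simpa using h.gaugeAC)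
  normACLoc a b hab hG := GaugeAC.reverse (fun v => norm_neg v) hab
    (h.normACLoc _ _ (by linarith) fun r hr => by
      have := mem_unstableTimes_reverse.1
        (hG (⟨by linarith [hr.2], by linarith [hr.1]⟩ : 1 - r ∈ Icc a b))
      rwa [sub_sub_cancel] at this)
  left_end := by simpa using h.right_end
  right_end := by simpa using h.left_end

lemma finsler_neg (hsymm : ∀ v, S.Ψ (-v) = S.Ψ v) (t : ℝ) (u v : V) :
    S.finsler t u (-v) = S.finsler t u v := by
  by_cases hv : v = 0
  · rw [hv, neg_zero]
  · rw [finsler, if_neg (neg_ne_zero.2 hv), finsler, if_neg hv]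
    simp only [contactPotential, viscous, hsymm, smul_neg, norm_neg]

lemma curveCost_reverse (hsymm : ∀ v, S.Ψ (-v) = S.Ψ v) (t : ℝ) (ϑ : ℝ → V) :
    S.curveCost t (fun r => ϑ (1 - r)) = S.curveCost t ϑ := by
  have hd : ∀ r, S.costDensity t (fun r => ϑ (1 - r)) r = S.costDensity t ϑ (1 - r) := fun r => by
    by_cases hG : 1 - r ∈ S.unstableTimes t ϑ
    · rw [costDensity, if_pos (mem_unstableTimes_reverse.2 hG), costDensity, if_pos hG,
        deriv_comp_const_sub, finsler_neg hsymm]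
    · rw [costDensity, if_neg (fun h => hG (mem_unstableTimes_reverse.1 h)), costDensity,
        if_neg hG, metricDeriv_reverse hsymm]
  simp only [curveCost, hd]
  have h1 := (Measure.measurePreserving_sub_left volume (1 : ℝ)).setLIntegral_comp_preimage_emb
    (MeasurableEquiv.subLeft (1 : ℝ)).measurableEmbedding (S.costDensity t ϑ) (Ioo 0 1)
  simpa using h1

/-! ### Energy bound and compactness for transitions and for concentrating viscous curves. -/

/-- The cost of a transition bounds the energy drop. -/
lemma IsTransition.ofReal_energy_sub_le [TopologicalSpace.SeparableSpace V]
    (hV : RadonNikodymProperty V) (hS : S.Standing) {t : ℝ} (ht : t ∈ Icc (0 : ℝ) S.T) {u₀ u₁ : V}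
    {ϑ : ℝ → V} (h : S.IsTransition t u₀ u₁ ϑ) :
    ENNReal.ofReal (S.E t u₀ - S.E t u₁) ≤ S.curveCost t ϑ := by
  by_cases hfin : S.curveCost t ϑ = ⊤
  · rw [hfin]; exact le_top
  obtain ⟨m, hm0, hmi, hmle, hm, hmeq⟩ := h.exists_majorant hV hS ht hfin
  obtain ⟨e, he, hϑe⟩ := h.exists_sublevel
  rw [hmeq, ← h.left_end, ← h.right_end]
  exact ENNReal.ofReal_le_ofReal
    (hm.energy_sub_le hS he ht (h.continuousOn hS) hϑe hm0 hmi hmle le_rfl zero_le_one)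

/-- Compactness of transitions of bounded cost, with lower semicontinuity of the cost. -/
lemma exists_transition_of_tendsto [CompleteSpace V] [TopologicalSpace.SeparableSpace V]
    (hV : RadonNikodymProperty V) (hS : S.Standing) {t : ℝ} (ht : t ∈ Icc (0 : ℝ) S.T) {e : ℝ}
    (he : 0 < e) {um up : V} {u₀ u₁ : ℕ → V} (hu₀ : ∀ n, u₀ n ∈ S.sublevel e)
    (hu₁ : ∀ n, u₁ n ∈ S.sublevel e) (hlim₀ : Tendsto u₀ atTop (𝓝 um))
    (hlim₁ : Tendsto u₁ atTop (𝓝 up)) {c : ℕ → ℝ} {cl : ℝ} (hc0 : ∀ n, 0 ≤ c n)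
    (hc : Tendsto c atTop (𝓝 cl))
    (hϑ : ∀ n, S.cost t (u₀ n) (u₁ n) < ENNReal.ofReal (c n)) :
    ∃ ϑ, S.IsTransition t um up ϑ ∧ S.curveCost t ϑ ≤ ENNReal.ofReal cl := by
  have hex : ∀ n, ∃ ϑ, S.IsTransition t (u₀ n) (u₁ n) ϑ ∧
      S.curveCost t ϑ < ENNReal.ofReal (c n) := fun n => by
    have := hϑ n
    simp only [cost, iInf_lt_iff] at this
    obtain ⟨ϑ, h1, h2⟩ := this
    exact ⟨ϑ, h1, h2⟩
  choose ϑ hT hcost using hex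
  have hmaj := fun n => (hT n).exists_majorant hV hS ht (hcost n).ne_top
  choose m hm0 hmi hmle hm hmeq using hmaj
  have hmc : ∀ n, ∫ r in (0 : ℝ)..1, m n r ≤ c n := fun n => by
    rw [← ENNReal.ofReal_le_ofReal_iff (hc0 n), ← hmeq n]
    exact (hcost n).le
  have hnn : ∀ n p q, p ≤ q → 0 ≤ ∫ r in p..q, m n r := fun n p q hpq =>
    intervalIntegral.integral_nonneg hpq fun r _ => hm0 n r
  have hadd : ∀ n r, (∫ s in (0 : ℝ)..r, m n s) + ∫ s in r..1, m n s = ∫ s in (0 : ℝ)..1, m n s :=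
    fun n r => intervalIntegral.integral_add_adjacent_intervals (hmi n).intervalIntegrable
      (hmi n).intervalIntegrable
  obtain ⟨B, hB⟩ := hc.bddAbove_range
  have hcB : ∀ n, c n ≤ B := fun n => hB ⟨n, rfl⟩
  -- Each transition comes with its own sublevel. A common one exists: the chain rule from `r` to
  -- `1` bounds the energy by `e + B`, and the increment from the left end bounds `Ψ` by `P + B`.
  obtain ⟨P, hP⟩ := (hS.E_coercive e he).bddAbove_image hS.psi_continuous.continuousOn
  obtain ⟨e', he', hlevel⟩ := exists_level hS (P + B + (e + B))
  have hϑe : ∀ n, ∀ r ∈ Icc (0 : ℝ) 1, ϑ n r ∈ S.sublevel e' := by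
    intro n r hr
    obtain ⟨en, hen, hϑen⟩ := (hT n).exists_sublevel
    refine hlevel t ht _ (hϑen r hr).1 ?_
    have h1 := (hm n).energy_sub_le hS hen ht ((hT n).continuousOn hS) hϑen (hm0 n) (hmi n)
      (hmle n) hr.1 hr.2
    rw [(hT n).right_end] at h1
    have h2 := (hu₁ n).2 t ht
    have h3 := hS.psi_nonneg (u₁ n)
    have h4 : S.Ψ (u₀ n) ≤ P := hP ⟨_, hu₀ n, rfl⟩
    have h5 := hm n 0 r 0 le_rfl hr.1 hr.2 le_rfl (by simp)
    rw [(hT n).left_end] at h5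
    have h6 := hS.isGauge.add_le (ϑ n r - u₀ n) (u₀ n)
    rw [sub_add_cancel] at h6
    linarith [hnn n 0 r hr.1, hnn n r 1 hr.2, hadd n r, hmc n, hcB n]
  -- `κ = 1 / (n + 1)` vanishes in the limit, so the speed constants still tend to `cl`.
  have hrep := fun n : ℕ => exists_reparametrization (hm0 n) (hmi n) (zero_le_one (α := ℝ))
    (by positivity : (0 : ℝ) < 1 / ((n : ℝ) + 1))
  choose τ hτac hτimg hτm hτs hτ0 hτ1 hτ using hrep
  have hτI : ∀ n, ∀ r ∈ Icc (0 : ℝ) 1, τ n r ∈ Icc (0 : ℝ) 1 := fun n r hr =>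
    hτimg n ▸ mem_image_of_mem _ hr
  obtain ⟨φ, ϑl, -, hTl, -, hcl⟩ := exists_limit_transition hS he' ht (u₀ := um) (u₁ := up)
    (η := fun n r => ϑ n (τ n r)) (w := fun n r => ϑ n (τ n r)) (ts := fun _ _ => t)
    (C := fun n => 1 / ((n : ℝ) + 1) + c n) (Cl := 0 + cl) (fun _ _ _ => ht)
    (fun n r hr => hϑe n _ (hτI n r hr)) (fun δ hδ => Eventually.of_forall fun n r _ => by
      simpa using hδ.le)
    (by
      rw [Metric.tendstoUniformlyOn_iff]
      exact fun δ hδ => Eventually.of_forall fun n r _ => by simpa using hδ)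
    (fun n => add_nonneg (by positivity) (hc0 n))
    (tendsto_one_div_add_atTop_nhds_zero_nat.add hc)
    (fun n p q a hp hpq hq ha hlow => by
      have hp' : p ∈ Icc (0 : ℝ) 1 := ⟨hp, hpq.trans hq⟩
      have hq' : q ∈ Icc (0 : ℝ) 1 := ⟨hp.trans hpq, hq⟩
      have h1 := hm n (τ n p) (τ n q) a (hτI n p hp').1 (hτm n hp' hq' hpq) (hτI n q hq').2 ha
        fun s hs => by
          obtain ⟨r, hr, rfl⟩ :=
            Icc_subset_image_of_monotoneOn (hτm n) (hτimg n) hp' hq' hpq hs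
          exact hlow r hr
      refine h1.trans ((hτ n p hp' q hq' hpq).trans ?_)
      refine mul_le_mul_of_nonneg_right ?_ (sub_nonneg.2 hpq)
      rw [sub_zero, mul_one]
      linarith [hmc n])
    (by simpa only [hτ0, (hT _).left_end] using hlim₀)
    (by simpa only [hτ1, (hT _).right_end] using hlim₁)
  exact ⟨ϑl, hTl, by simpa using hcl⟩

lemma exists_sub_lt_of_liminf {f : ℕ → ℝ≥0∞} (h : liminf f atTop ≠ ⊤) :
    ∃ φ : ℕ → ℕ, StrictMono φ ∧
      ∀ k, f (φ k) < ENNReal.ofReal ((liminf f atTop).toReal + 1 / ((k : ℝ) + 1)) := by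
  refine extraction_forall_of_frequently (P := fun k n =>
    f n < ENNReal.ofReal ((liminf f atTop).toReal + 1 / ((k : ℝ) + 1))) fun k => ?_
  refine frequently_lt_of_liminf_lt (by isBoundedDefault) ?_
  rw [ENNReal.lt_ofReal_iff_toReal_lt h]
  exact lt_add_of_pos_right _ (by positivity)

lemma IsConcentrating.comp {e t : ℝ} {um up : V} {α β : ℕ → ℝ} {u w : ℕ → ℝ → V}
    {ξ : ℕ → ℝ → V →L[ℝ] ℝ} {ε : ℕ → ℝ} (h : S.IsConcentrating e t um up α β u w ξ ε) {φ : ℕ → ℕ}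
    (hφ : StrictMono φ) : S.IsConcentrating e t um up (α ∘ φ) (β ∘ φ) (u ∘ φ) (w ∘ φ) (ξ ∘ φ)
      (ε ∘ φ) where
  interval _ := h.interval _
  u_ac _ := h.u_ac _
  w_mem _ := h.w_mem _
  w_meas _ := h.w_meas _
  xi_integrable _ := h.xi_integrable _
  eps_pos _ := h.eps_pos _
  eps_tendsto := h.eps_tendsto.comp hφ.tendsto_atTop
  close δ hδ := hφ.tendsto_atTop.eventually (h.close δ hδ)
  xi_mem _ := h.xi_mem _
  u_left := h.u_left.comp hφ.tendsto_atTop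
  u_right := h.u_right.comp hφ.tendsto_atTop
  alpha_tendsto := h.alpha_tendsto.comp hφ.tendsto_atTop
  beta_tendsto := h.beta_tendsto.comp hφ.tendsto_atTop

/-- Compactness of concentrating viscous sequences of bounded dissipation. -/
lemma IsConcentrating.exists_limit [CompleteSpace V] [TopologicalSpace.SeparableSpace V]
    (hV : RadonNikodymProperty V) (hS : S.Standing) {t : ℝ} (ht : t ∈ Icc (0 : ℝ) S.T) {e : ℝ}
    (he : 0 < e) {um up : V} {α β : ℕ → ℝ} {u w : ℕ → ℝ → V}
    {ξ : ℕ → ℝ → V →L[ℝ] ℝ} {ε : ℕ → ℝ} (h : S.IsConcentrating e t um up α β u w ξ ε)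
    {c : ℕ → ℝ} {cl : ℝ} (hc0 : ∀ n, 0 ≤ c n) (hc : Tendsto c atTop (𝓝 cl))
    (hdiss : ∀ n, S.viscousDissipation (ε n) (α n) (β n) (u n) (ξ n) ≤ ENNReal.ofReal (c n)) :
    ∃ (k : ℕ → ℕ) (τ : ℕ → ℝ → ℝ) (ϑ : ℝ → V),
      StrictMono k ∧
      (∀ j, NormAC (τ j) 0 1 ∧ τ j '' Icc 0 1 = Icc (α (k j)) (β (k j)) ∧
        MonotoneOn (τ j) (Icc 0 1) ∧ (α (k j) < β (k j) → StrictMonoOn (τ j) (Icc 0 1))) ∧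
      S.IsTransition t um up ϑ ∧
      TendstoUniformlyOn (fun j r => u (k j) (τ j r)) ϑ atTop (Icc 0 1) ∧
      S.curveCost t ϑ ≤ ENNReal.ofReal cl := by
  have hmin := fun n => exists_integrable_minorant
    (ne_top_of_le_ne_top ENNReal.ofReal_ne_top (hdiss n))
  choose m hm0 hmi hmle hmeq using hmin
  have hαβ := fun n => (h.interval n).2.1
  have hmc : ∀ n, ∫ r in α n..β n, m n r ≤ c n := fun n => by
    rw [← ENNReal.ofReal_le_ofReal_iff (hc0 n), ← hmeq n _ _ le_rfl (hαβ n) le_rfl]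
    exact hdiss n
  obtain ⟨L, hL, hΨL⟩ := hS.isGauge.exists_le_mul_norm hS.psi_continuous
  -- The majorant inequality for viscous curves: increments of `u n`, but the instability of the
  -- companion `w n` at the running time. The bound does not depend on `ε n`.
  have hmaj : ∀ n, ∀ p q a : ℝ, α n ≤ p → p ≤ q → q ≤ β n → 0 ≤ a →
      (∀ r ∈ Icc p q, ENNReal.ofReal a ≤ S.instability r (w n r)) →
        S.Ψ (u n q - u n p) + a * ‖u n q - u n p‖ ≤ ∫ r in p..q, m n r := by
    intro n p q a hp hpq hq ha hlow
    rw [← ENNReal.ofReal_le_ofReal_iff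
      (intervalIntegral.integral_nonneg hpq fun r _ => hm0 n r), ← hmeq n p q hp hpq hq]
    have hN := hS.isGauge.add_norm ha
    have hcN : Continuous fun v : V => S.Ψ v + a * ‖v‖ :=
      hS.psi_continuous.add (continuous_const.mul continuous_norm)
    have hac : GaugeAC (fun v : V => S.Ψ v + a * ‖v‖) (u n) p q :=
      GaugeAC.mono (L := L + a) (h.u_ac n) hp hq (by linarith)
        fun v => by rw [add_mul]; linarith [hΨL v]
    refine (hN.ofReal_sub_le_lintegral_metricDeriv hpq hac).trans (lintegral_mono_ae ?_)
    have hsub : Ioo p q ⊆ Ioo (α n) (β n) := Ioo_subset_Ioo hp hq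
    filter_upwards [ae_mono (Measure.restrict_mono hsub le_rfl) (hV _ _ _ (h.u_ac n)),
      ae_mono (Measure.restrict_mono hsub le_rfl) (h.xi_mem n),
      ae_restrict_mem measurableSet_Ioo] with r h1 h2 h3
    rw [metricDeriv_of_differentiableAt hcN h1]
    exact le_viscous_add_viscousConj hS (h.eps_pos n) h2 (hlow r (Ioo_subset_Icc_self h3)) _
  -- Here `κ = 1` suffices, since the interval lengths tend to `0`.
  have hrep := fun n : ℕ => exists_reparametrization (hm0 n) (hmi n) (hαβ n) one_pos
  choose τ hτac hτimg hτm hτs hτ0 hτ1 hτ using hrep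
  have hτI : ∀ n, ∀ r ∈ Icc (0 : ℝ) 1, τ n r ∈ Icc (α n) (β n) := fun n r hr =>
    hτimg n ▸ mem_image_of_mem _ hr
  obtain ⟨φ, ϑ, hφ, hT, hunif, hcost⟩ := exists_limit_transition hS he ht (u₀ := um) (u₁ := up)
    (η := fun n r => u n (τ n r)) (w := fun n r => w n (τ n r)) (ts := τ)
    (C := fun n => 1 * (β n - α n) + c n) (Cl := 1 * (t - t) + cl)
    (fun n r hr => ⟨(h.interval n).1.trans (hτI n r hr).1, (hτI n r hr).2.trans (h.interval n).2.2⟩)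
    (fun n r hr => h.w_mem n _ (hτI n r hr))
    (fun δ hδ => (h.close δ hδ).mono fun n hn r hr => hn _ (hτI n r hr))
    (by
      rw [Metric.tendstoUniformlyOn_iff]
      intro δ hδ
      filter_upwards [Metric.tendsto_nhds.1 h.alpha_tendsto δ hδ,
        Metric.tendsto_nhds.1 h.beta_tendsto δ hδ] with n h1 h2 r hr
      rw [Real.dist_eq, abs_lt] at *
      have h3 := hτI n r hr
      exact ⟨by linarith [h3.2], by linarith [h3.1]⟩)
    (fun n => add_nonneg (by linarith [hαβ n]) (hc0 n))
    (((h.beta_tendsto.sub h.alpha_tendsto).const_mul 1).add hc)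
    (fun n p q a hp hpq hq ha hlow => by
      have hp' : p ∈ Icc (0 : ℝ) 1 := ⟨hp, hpq.trans hq⟩
      have hq' : q ∈ Icc (0 : ℝ) 1 := ⟨hp.trans hpq, hq⟩
      have h1 := hmaj n (τ n p) (τ n q) a (hτI n p hp').1 (hτm n hp' hq' hpq) (hτI n q hq').2 ha
        fun s hs => by
          obtain ⟨r, hr, rfl⟩ :=
            Icc_subset_image_of_monotoneOn (hτm n) (hτimg n) hp' hq' hpq hs
          exact hlow r hr
      refine h1.trans ((hτ n p hp' q hq' hpq).trans ?_)
      refine mul_le_mul_of_nonneg_right ?_ (sub_nonneg.2 hpq)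
      linarith [hmc n])
    (by simpa only [hτ0] using h.u_left) (by simpa only [hτ1] using h.u_right)
  exact ⟨φ, fun j => τ (φ j), ϑ, hφ, fun j => ⟨hτac _, hτimg _, hτm _, hτs _⟩, hT, hunif,
    by simpa using hcost⟩

end RISystem

/-! ### Proof of the theorem. -/

theorem mainTheorem7 {V : Type*} [NormedAddCommGroup V] [NormedSpace ℝ V] [CompleteSpace V]
    [TopologicalSpace.SeparableSpace V] (hV : RadonNikodymProperty V)
    (S : RISystem V) (hS : S.Standing)
    (t : ℝ) (ht : t ∈ Icc (0 : ℝ) S.T) (e : ℝ) (he : 0 < e)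
    (um up : V) (hum : um ∈ S.sublevel e) (hup : up ∈ S.sublevel e) :
    -- (F1)
    ((S.cost t um up < ⊤ →
        ∃ ϑ : ℝ → V, S.IsTransition t um up ϑ ∧ S.curveCost t ϑ = S.cost t um up) ∧
      ENNReal.ofReal (S.E t um - S.E t up) ≤ S.cost t um up ∧
      ((∀ v : V, S.Ψ (-v) = S.Ψ v) →
        ENNReal.ofReal |S.E t um - S.E t up| ≤ S.cost t um up)) ∧
    -- (F2)
    (∀ u₀ u₁ : ℕ → V, (∀ n, u₀ n ∈ S.sublevel e) → (∀ n, u₁ n ∈ S.sublevel e) →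
      Tendsto u₀ atTop (𝓝 um) → Tendsto u₁ atTop (𝓝 up) →
        S.cost t um up ≤ liminf (fun n => S.cost t (u₀ n) (u₁ n)) atTop) ∧
    -- (F3)
    (∀ (α β : ℕ → ℝ) (u w : ℕ → ℝ → V) (ξ : ℕ → ℝ → V →L[ℝ] ℝ) (ε : ℕ → ℝ),
      S.IsConcentrating e t um up α β u w ξ ε →
        (∀ Δ : ℝ≥0∞, Δ < ⊤ →
          Tendsto (fun n => S.viscousDissipation (ε n) (α n) (β n) (u n) (ξ n)) atTop (𝓝 Δ) →
          ∃ (k : ℕ → ℕ) (τ : ℕ → ℝ → ℝ) (ϑ : ℝ → V),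
            StrictMono k ∧
            (∀ j, NormAC (τ j) 0 1 ∧ τ j '' Icc 0 1 = Icc (α (k j)) (β (k j)) ∧
              MonotoneOn (τ j) (Icc 0 1) ∧
              (α (k j) < β (k j) → StrictMonoOn (τ j) (Icc 0 1))) ∧
            S.IsTransition t um up ϑ ∧
            TendstoUniformlyOn (fun j r => u (k j) (τ j r)) ϑ atTop (Icc 0 1) ∧
            S.curveCost t ϑ ≤ Δ) ∧
        S.cost t um up ≤
          liminf (fun n => S.viscousDissipation (ε n) (α n) (β n) (u n) (ξ n)) atTop) := by
  refine ⟨⟨fun hfin => ?_, ?_, fun hsymm => ?_⟩, fun u₀ u₁ hu₀ hu₁ hlim₀ hlim₁ => ?_,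
    fun α β u w ξ ε hc => ⟨fun Δ hΔ hlim => ?_, ?_⟩⟩
  -- Compactness of a minimising sequence with constant end points.
  · obtain ⟨ϑ, hT, hle⟩ := RISystem.exists_transition_of_tendsto hV hS ht he (fun _ => hum)
      (fun _ => hup) tendsto_const_nhds tendsto_const_nhds
      (c := fun n : ℕ => (S.cost t um up).toReal + 1 / ((n : ℝ) + 1))
      (fun n => by positivity)
      (tendsto_const_nhds.add tendsto_one_div_add_atTop_nhds_zero_nat)
      (fun n => by
        rw [ENNReal.lt_ofReal_iff_toReal_lt hfin.ne]
        exact lt_add_of_pos_right _ (by positivity))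
    rw [add_zero, ENNReal.ofReal_toReal hfin.ne] at hle
    exact ⟨ϑ, hT, le_antisymm hle (iInf₂_le ϑ hT)⟩
  · exact le_iInf₂ fun ϑ hT => hT.ofReal_energy_sub_le hV hS ht
  · refine le_iInf₂ fun ϑ hT => ?_
    rcases abs_cases (S.E t um - S.E t up) with ⟨h, -⟩ | ⟨h, -⟩
    · rw [h]
      exact hT.ofReal_energy_sub_le hV hS ht
    · rw [h, neg_sub, ← RISystem.curveCost_reverse hsymm]
      exact (hT.reverse hsymm).ofReal_energy_sub_le hV hS ht
  · by_cases hfin : liminf (fun n => S.cost t (u₀ n) (u₁ n)) atTop = ⊤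
    · rw [hfin]; exact le_top
    obtain ⟨φ, hφ, hlt⟩ := RISystem.exists_sub_lt_of_liminf hfin
    obtain ⟨ϑ, hT, hle⟩ := RISystem.exists_transition_of_tendsto hV hS ht he (fun n => hu₀ (φ n))
      (fun n => hu₁ (φ n)) (hlim₀.comp hφ.tendsto_atTop) (hlim₁.comp hφ.tendsto_atTop)
      (fun n => by positivity)
      (tendsto_const_nhds.add tendsto_one_div_add_atTop_nhds_zero_nat) hlt
    rw [add_zero, ENNReal.ofReal_toReal hfin] at hle
    exact (iInf₂_le ϑ hT).trans hle
  -- Finitely many dissipations may be infinite although the limit is finite; these indices are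
  -- shifted away.
  · obtain ⟨N, hN⟩ := eventually_atTop.1 (hlim.eventually_lt_const hΔ)
    have hshift : StrictMono fun n => n + N := fun a b hab => by simpa using hab
    obtain ⟨k, τ, ϑ, hk, hτ, hT, hunif, hle⟩ := (hc.comp hshift).exists_limit hV hS ht he
      (fun n => ENNReal.toReal_nonneg)
      ((ENNReal.tendsto_toReal hΔ.ne).comp (hlim.comp hshift.tendsto_atTop))
      (fun n => (ENNReal.ofReal_toReal (hN (n + N) (Nat.le_add_left _ _)).ne).ge)
    rw [ENNReal.ofReal_toReal hΔ.ne] at hle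
    exact ⟨fun j => k j + N, τ, ϑ, hshift.comp hk, hτ, hT, hunif, hle⟩
  · by_cases hfin : liminf (fun n => S.viscousDissipation (ε n) (α n) (β n) (u n) (ξ n)) atTop = ⊤
    · rw [hfin]; exact le_top
    obtain ⟨φ, hφ, hlt⟩ := RISystem.exists_sub_lt_of_liminf hfin
    obtain ⟨k, τ, ϑ, hk, hτ, hT, hunif, hle⟩ := (hc.comp hφ).exists_limit hV hS ht he
      (fun n => by positivity)
      (tendsto_const_nhds.add tendsto_one_div_add_atTop_nhds_zero_nat) (fun n => (hlt n).le)
    rw [add_zero, ENNReal.ofReal_toReal hfin] at hle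
    exact (iInf₂_le ϑ hT).trans hle
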